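/- All spaces are finite-dimensional real inner product spaces, $\mathbb{N}$ denotes the positive integers, $[n]=\{1,\dots,n\}$, and $S_n$ is the symmetric group on $[n]$. A \emph{consistent sequence} $\mathscr V$ consists of a directed partial order $\preceq$ on $\mathbb N$, nested embeddings of groups $S_n\subset S_N$ for $n\preceq N$, orthogonal representations $V_n$ of $S_n$, and injective $S_n$-equivariant linear maps $\varphi_{N,n}\colon V_n\to V_N$ for $n\preceq N$ with $\varphi_{n,n}=\mathrm{id}$ and $\varphi_{M,N}\varphi_{N,n}=\varphi_{M,n}$. Write $\varphi^\star$ for the adjoint of a linear map $\varphi$ and $\mathrm{sym}^{\mathscr V}_N=\frac{1}{|S_N|}\sum_{g\in S_N} g\,\varphi_{N,n}\colon V_n^{S_n}\to V_N^{S_N}$. The space of \emph{freely-described} elements is $$\varprojlim_{\mathscr V} V_n^{S_n}=\Big\{(v_n)\in\prod_n V_n^{S_n} : \varphi_{N,n}^\star v_N=v_n\ \text{for all } n\preceq N\Big\},$$ and the space $\varinjlim_{\mathscr V}V_n^{S_n}$ of \emph{freely-symmetrized} elements is the direct limit of the spaces $V_n^{S_n}$ along the maps $\mathrm{sym}^{\mathscr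 V}_N$; the class of $v_k\in V_k^{S_k}$ is written $(\mathrm{sym}^{\mathscr V}_n v_k)_{n\succeq k}$. Let $\mathscr Z$ be the consistent sequence $(\mathbb R^n)_n$ with the standard inner products and permutation actions, the order $\le$, and the zero-padding maps $x\mapsto(x,0)$. Let $\mathscr D$ be the consistent sequence on the same spaces with the divisibility order and the duplication maps $x\mapsto(x_1,\dots,x_1,\dots,x_n,\dots,x_n)$ from $\mathbb R^n$ to $\mathbb R^N$ for $n\mid N$, each entry being repeated $N/n$ times. A \emph{construction} $\mathcal F$ is obtained from the identity by finitely many products $\mathcal F_1\times\mathcal F_2$, tensor products $\mathcal F_1\otimes\mathcal F_2$ and symmetric powers $\mathrm{Sym}^k\mathcal F_1$ (symmetric tensors in the $k$-th tensor power), applied to spaces and to linear maps, with the product and Frobenius inner products. An \emph{FS-pair} is a pair $(\mathscr U,\mathscr L)$ equal to $(\mathcal F(\mathscr D),\mathcal F(\mathscr Z))$ or $(\mathcal F(\mathscr Z),\mathcal F(\mathscr D))$ for a construction $\mathcal F$; both members have the same spaces $V_n=\mathcal F(\mathbb R^n)$. For $f\colon[m]\to[n]$ let $\rho(f)\colon V_n\to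 V_m$ be the result of applying $\mathcal F$ to the map $\mathbb R^n\to\mathbb R^m$, $x\mapsto(x_{f(i)})_{i\in[m]}$. The \emph{de Finetti map} $L_{k,n}\colon V_n\to V_k$ is the random linear map $\rho(F)$ with $F\colon[k]\to[n]$ uniformly random if $\mathscr U=\mathcal F(\mathscr D)$, and $\rho(F)^\star$ with $F\colon[n]\to[k]$ uniformly random if $\mathscr U=\mathcal F(\mathscr Z)$. \textbf{Proposition.} Let $(\mathscr U,\mathscr L)$ be an FS-pair on $(V_n)$. Then the map from $\varinjlim_{\mathscr L}V_n^{S_n}$ to $\varprojlim_{\mathscr U}V_n^{S_n}$ sending $$(\mathrm{sym}^{\mathscr L}_n v_k)_{n\succeq_{\mathscr L}k}\ \longmapsto\ \big(\mathbb E\,L_{k,n}^\star v_k\big)_{n}$$ for $k\in\mathbb N$ and $v_k\in V_k^{S_k}$ is well defined and is a linear isomorphism. -/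

import Mathlib

open scoped TensorProduct

noncomputable section

/-! ### Finite-dimensional real inner product spaces and standard constructions -/

/-- A finite-dimensional real inner product space. -/
structure EuclSpace where
  carrier : Type
  [instNormed : NormedAddCommGroup carrier]
  [instInner : InnerProductSpace ℝ carrier]
  [instFinite : FiniteDimensional ℝ carrier]

namespace EuclSpace

attribute [instance] EuclSpace.instNormed EuclSpace.instInner EuclSpace.instFinite

instance : CoeSort EuclSpace Type := ⟨EuclSpace.carrier⟩

/-- `ℝⁿ` with its standard inner product. -/
abbrev std (n : ℕ) : EuclSpace := ⟨EuclideanSpace ℝ (Fin n)⟩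

/-- The Cartesian product, with `⟪(x, y), (x', y')⟫ = ⟪x, x'⟫ + ⟪y, y'⟫`. -/
abbrev prod (X Y : EuclSpace) : EuclSpace := ⟨WithLp 2 (X × Y)⟩

/-- The tensor product, with `⟪x ⊗ y, x' ⊗ y'⟫ = ⟪x, x'⟫ * ⟪y, y'⟫`. -/
abbrev tensor (X Y : EuclSpace) : EuclSpace := ⟨X ⊗[ℝ] Y⟩

/-- The tensor power `X^{⊗k}`. -/
abbrev TensorPow (k : ℕ) (X : EuclSpace) : Type := ⨂[ℝ] _ : Fin k, X

/-- The Frobenius inner product on `X^{⊗k}`, as a bilinear form: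
`⟪x₁ ⊗ ⋯ ⊗ x_k, y₁ ⊗ ⋯ ⊗ y_k⟫ = ∏ i, ⟪x i, y i⟫`. -/
def frobenius (k : ℕ) (X : EuclSpace) :
    TensorPow k X →ₗ[ℝ] TensorPow k X →ₗ[ℝ] ℝ :=
  PiTensorProduct.dualDistrib ∘ₗ PiTensorProduct.map (fun _ => innerₗ X)

theorem frobenius_tprod {k : ℕ} {X : EuclSpace} (x y : Fin k → X) :
    frobenius k X (PiTensorProduct.tprod ℝ x) (PiTensorProduct.tprod ℝ y) =
      ∏ i, inner ℝ (x i) (y i) := by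
  simp [frobenius, PiTensorProduct.map_tprod]

theorem frobenius_basis {k : ℕ} {X : EuclSpace} (s t : TensorPow k X) :
    frobenius k X s t =
      ∑ p, (Basis.piTensorProduct fun _ : Fin k => (stdOrthonormalBasis ℝ X).toBasis).repr s p *
        (Basis.piTensorProduct fun _ : Fin k => (stdOrthonormalBasis ℝ X).toBasis).repr t p := by
  classical
  set b := Basis.piTensorProduct fun _ : Fin k => (stdOrthonormalBasis ℝ X).toBasis with hb
  have key : ∀ p q, frobenius k X (b p) (b q) = if p = q then 1 else 0 := by
    intro p q
    rw [hb, Basis.piTensorProduct_apply, Basis.piTensorProduct_apply, frobenius_tprod]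
    simp [OrthonormalBasis.inner_eq_ite, Fintype.prod_ite_zero, ← funext_iff]
  calc frobenius k X s t
      = frobenius k X (∑ p, b.repr s p • b p) (∑ q, b.repr t q • b q) := by
        rw [b.sum_repr, b.sum_repr]
    _ = _ := by
        simp only [map_sum, map_smul, LinearMap.sum_apply, LinearMap.smul_apply, key, smul_eq_mul,
          mul_ite, mul_one, mul_zero, Finset.sum_ite_eq', Finset.mem_univ, if_true]
        exact Finset.sum_congr rfl fun p _ => mul_comm _ _

/-- The symmetric tensors `Sym^k X ⊆ X^{⊗k}`: those fixed by all permutations of the factors. -/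
def symTensors (k : ℕ) (X : EuclSpace) : Submodule ℝ (TensorPow k X) where
  carrier := {t | ∀ σ : Equiv.Perm (Fin k), PiTensorProduct.reindex ℝ (fun _ => X) σ t = t}
  add_mem' := by
    intro a b ha hb σ
    exact (map_add (PiTensorProduct.reindex ℝ (fun _ => (X : Type)) σ) a b).trans
      (congrArg₂ (· + ·) (ha σ) (hb σ))
  zero_mem' := fun σ => map_zero (PiTensorProduct.reindex ℝ (fun _ => (X : Type)) σ)
  smul_mem' := by
    intro c a ha σ
    exact (map_smul (PiTensorProduct.reindex ℝ (fun _ => (X : Type)) σ) c a).trans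
      (congrArg (c • ·) (ha σ))

/-- `Sym^k X` as a type. -/
def SymTensor (k : ℕ) (X : EuclSpace) : Type := ↥(symTensors k X)

namespace SymTensor

variable (k : ℕ) (X : EuclSpace)

/-- The inner product on `Sym^k X` is the restriction of the Frobenius inner product. -/
@[reducible]
def core : @InnerProductSpace.Core ℝ (symTensors k X) _ _ _ where
  inner s t := frobenius k X s t
  conj_inner_symm s t := by
    simp only [frobenius_basis, conj_trivial]
    exact Finset.sum_congr rfl fun p _ => mul_comm _ _
  re_inner_nonneg s := by
    simp only [frobenius_basis, RCLike.re_to_real]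
    exact Finset.sum_nonneg fun p _ => mul_self_nonneg _
  add_left s t u := by simp
  smul_left s t r := by simp
  definite s hs := by
    simp only [frobenius_basis] at hs
    rw [Finset.sum_eq_zero_iff_of_nonneg fun p _ => mul_self_nonneg _] at hs
    apply Subtype.ext
    apply (Basis.piTensorProduct
      fun _ : Fin k => (stdOrthonormalBasis ℝ X).toBasis).ext_elem
    intro p
    simpa using hs p (Finset.mem_univ p)

instance : NormedAddCommGroup (SymTensor k X) := (core k X).toNormedAddCommGroup

instance : InnerProductSpace ℝ (SymTensor k X) := InnerProductSpace.ofCore (core k X).toCore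

/-- The inclusion `Sym^k X ⊆ X^{⊗k}`. -/
def incl : SymTensor k X →ₗ[ℝ] TensorPow k X := (symTensors k X).subtype

theorem incl_injective : Function.Injective (incl k X) := Subtype.val_injective

instance : FiniteDimensional ℝ (SymTensor k X) :=
  FiniteDimensional.of_injective (incl k X) (incl_injective k X)

theorem inner_eq (s t : SymTensor k X) :
    inner ℝ s t = frobenius k X (incl k X s) (incl k X t) := rfl

end SymTensor

/-- `Sym^k X` with the Frobenius inner product. -/
abbrev sym (k : ℕ) (X : EuclSpace) : EuclSpace := ⟨SymTensor k X⟩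

/-- `(x, y) ↦ (S x, T y)`. -/
def prodMap {X X' Y Y' : EuclSpace} (S : X →ₗ[ℝ] X') (T : Y →ₗ[ℝ] Y') :
    X.prod Y →ₗ[ℝ] X'.prod Y' :=
  (WithLp.linearEquiv 2 ℝ (X' × Y')).symm.toLinearMap ∘ₗ S.prodMap T ∘ₗ
    (WithLp.linearEquiv 2 ℝ (X × Y)).toLinearMap

/-- The restriction of `T^{⊗k}` to symmetric tensors. -/
def symMap (k : ℕ) {X Y : EuclSpace} (T : X →ₗ[ℝ] Y) : X.sym k →ₗ[ℝ] Y.sym k :=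
  LinearMap.codRestrict (symTensors k Y)
    (PiTensorProduct.map (fun _ : Fin k => T) ∘ₗ SymTensor.incl k X) (by
      intro s σ
      have h := PiTensorProduct.map_reindex (fun _ : Fin k => T) σ (SymTensor.incl k X s)
      exact h.symm.trans (congrArg (PiTensorProduct.map fun _ : Fin k => T) (s.2 σ)))

theorem incl_symMap {k : ℕ} {X Y : EuclSpace} (T : X →ₗ[ℝ] Y) (s : X.sym k) :
    SymTensor.incl k Y (symMap k T s) =
      PiTensorProduct.map (fun _ : Fin k => T) (SymTensor.incl k X s) := rfl

theorem frobenius_map {k : ℕ} {X Y : EuclSpace} {T : X →ₗ[ℝ] Y}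
    (hT : ∀ x y, inner ℝ (T x) (T y) = inner ℝ x y) (s t : TensorPow k X) :
    frobenius k Y (PiTensorProduct.map (fun _ => T) s) (PiTensorProduct.map (fun _ => T) t) =
      frobenius k X s t := by
  induction s using PiTensorProduct.induction_on with
  | smul_tprod r x =>
    induction t using PiTensorProduct.induction_on with
    | smul_tprod r' y => simp [PiTensorProduct.map_tprod, frobenius_tprod, hT]
    | add t t' h h' => simp only [map_add, h, h']
  | add s s' h h' => simp only [map_add, LinearMap.add_apply, h, h']

end EuclSpace

/-- The constructions generated from the identity by products, tensor products and symmetric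
powers (for instance, polynomials of degree between `1` and `k` are the iterated product of the
`Sym^j` for `1 ≤ j ≤ k`). -/
inductive Construction where
  | id : Construction
  | prod (F G : Construction) : Construction
  | tensor (F G : Construction) : Construction
  | sym (k : ℕ) (F : Construction) : Construction

namespace Construction

/-- The value of a construction on a space. -/
def obj : Construction → EuclSpace → EuclSpace
  | id, X => X
  | prod F G, X => (F.obj X).prod (G.obj X)
  | tensor F G, X => (F.obj X).tensor (G.obj X)
  | sym k F, X => (F.obj X).sym k

/-- The value of a construction on a linear map:
`(F × G)(T) = F(T) × G(T)`, `(F ⊗ G)(T) = F(T) ⊗ G(T)` and `(Sym^k F)(T) = F(T)^{⊗k}`. -/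
def map : (F : Construction) → {X Y : EuclSpace} → (X →ₗ[ℝ] Y) → (F.obj X →ₗ[ℝ] F.obj Y)
  | id, _, _, T => T
  | prod F G, _, _, T => EuclSpace.prodMap (F.map T) (G.map T)
  | tensor F G, _, _, T => TensorProduct.map (F.map T) (G.map T)
  | sym k F, _, _, T => EuclSpace.symMap k (F.map T)

theorem map_id (F : Construction) (X : EuclSpace) :
    F.map (LinearMap.id : X →ₗ[ℝ] X) = LinearMap.id := by
  induction F with
  | id => rfl
  | prod F G hF hG =>
    simp only [map, hF, hG]
    rfl
  | tensor F G hF hG =>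
    simp only [map, hF, hG]
    exact TensorProduct.map_id
  | sym k F hF =>
    simp only [map, hF]
    refine LinearMap.ext fun s => EuclSpace.SymTensor.incl_injective _ _ ?_
    rw [EuclSpace.incl_symMap, PiTensorProduct.map_id]
    rfl

theorem map_comp (F : Construction) {X Y Z : EuclSpace} (S : Y →ₗ[ℝ] Z) (T : X →ₗ[ℝ] Y) :
    F.map (S ∘ₗ T) = F.map S ∘ₗ F.map T := by
  induction F with
  | id => rfl
  | prod F G hF hG =>
    simp only [map, hF, hG]
    rfl
  | tensor F G hF hG =>
    simp only [map, hF, hG]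
    exact TensorProduct.map_comp _ _ _ _
  | sym k F hF =>
    simp only [map, hF]
    refine LinearMap.ext fun s => EuclSpace.SymTensor.incl_injective _ _ ?_
    rw [EuclSpace.incl_symMap, PiTensorProduct.map_comp]
    rfl

theorem map_injective (F : Construction) {X Y : EuclSpace} {T : X →ₗ[ℝ] Y}
    (hT : Function.Injective T) : Function.Injective (F.map T) := by
  obtain ⟨S, hS⟩ := T.exists_leftInverse_of_injective (LinearMap.ker_eq_bot.mpr hT)
  refine Function.LeftInverse.injective (g := F.map S) fun x => ?_
  rw [← LinearMap.comp_apply, ← map_comp, hS, map_id]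
  rfl

theorem inner_map_map (F : Construction) {X Y : EuclSpace} {T : X →ₗ[ℝ] Y}
    (hT : ∀ x y, inner ℝ (T x) (T y) = inner ℝ x y) (x y : F.obj X) :
    inner ℝ (F.map T x) (F.map T y) = inner ℝ x y := by
  induction F with
  | id => exact hT x y
  | prod F G hF hG =>
    exact congrArg₂ (· + ·) (hF _ _) (hG _ _)
  | tensor F G hF hG =>
    exact TensorProduct.inner_map_map ((F.map T).isometryOfInner hF)
      ((G.map T).isometryOfInner hG) x y
  | sym k F hF => exact EuclSpace.frobenius_map hF _ _

end Construction

/-! ### Consistent sequences -/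

/-- A consistent sequence of symmetric group representations on a given sequence of spaces `V n`,
`n = 1, 2, …`. The maps `φ` are equivariant embeddings; they are not required to preserve inner
products, since duplication of entries does not preserve the standard one. -/
structure ConsistentSequence (V : ℕ+ → EuclSpace) where
  /-- The directed partial order on the indices. -/
  order : PartialOrder ℕ+
  directed : ∀ n m, ∃ N, order.le n N ∧ order.le m N
  /-- The nesting `S_n ⊆ S_N` of symmetric groups. -/
  emb : ∀ {n N : ℕ+}, order.le n N → (Equiv.Perm (Fin n) →* Equiv.Perm (Fin N))
  emb_injective : ∀ {n N : ℕ+} (h : order.le n N), Function.Injective (emb h)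
  emb_emb : ∀ {n N M : ℕ+} (h : order.le n N) (h' : order.le N M) (g : Equiv.Perm (Fin n)),
    emb h' (emb h g) = emb (order.le_trans _ _ _ h h') g
  /-- The action of `S_n` on `V n`. -/
  action : ∀ n : ℕ+, Representation ℝ (Equiv.Perm (Fin n)) (V n)
  action_inner : ∀ (n : ℕ+) (g : Equiv.Perm (Fin n)) (x y : V n),
    inner ℝ (action n g x) (action n g y) = inner ℝ x y
  /-- The embeddings `V n → V N`. -/
  φ : ∀ {n N : ℕ+}, order.le n N → (V n →ₗ[ℝ] V N)
  φ_injective : ∀ {n N : ℕ+} (h : order.le n N), Function.Injective (φ h)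
  φ_self : ∀ (n : ℕ+), φ (order.le_refl n) = LinearMap.id
  φ_comp : ∀ {n N M : ℕ+} (h : order.le n N) (h' : order.le N M),
    φ h' ∘ₗ φ h = φ (order.le_trans _ _ _ h h')
  φ_equivariant : ∀ {n N : ℕ+} (h : order.le n N) (g : Equiv.Perm (Fin n)),
    φ h ∘ₗ action n g = action N (emb h g) ∘ₗ φ h

/-- A construction applied to a consistent sequence. -/
def Construction.apply (F : Construction) {V : ℕ+ → EuclSpace} (S : ConsistentSequence V) :
    ConsistentSequence fun n => F.obj (V n) where
  order := S.order
  directed := S.directed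
  emb := S.emb
  emb_injective := S.emb_injective
  emb_emb := S.emb_emb
  action n :=
    { toFun := fun g => F.map (S.action n g)
      map_one' := by rw [map_one]; exact F.map_id _
      map_mul' := fun g h => by rw [map_mul]; exact F.map_comp _ _ }
  action_inner n g := F.inner_map_map (S.action_inner n g)
  φ h := F.map (S.φ h)
  φ_injective h := F.map_injective (S.φ_injective h)
  φ_self n := by rw [S.φ_self, F.map_id]
  φ_comp h h' := by rw [← F.map_comp, S.φ_comp]
  φ_equivariant h g := by
    change F.map _ ∘ₗ F.map _ = F.map _ ∘ₗ F.map _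
    rw [← F.map_comp, S.φ_equivariant, F.map_comp]

/-! ### Maps between finite sets, zero-padding and duplication -/

/-- The linear map `ρ(f) : ℝⁿ → ℝᵐ`, `(ρ(f) x) i = x (f i)`, of a map `f : [m] → [n]`. -/
def pullback {m n : ℕ} (f : Fin m → Fin n) :
    EuclideanSpace ℝ (Fin n) →ₗ[ℝ] EuclideanSpace ℝ (Fin m) where
  toFun x := WithLp.toLp 2 fun i => x (f i)
  map_add' _ _ := rfl
  map_smul' _ _ := rfl

theorem pullback_apply {m n : ℕ} (f : Fin m → Fin n) (x : EuclideanSpace ℝ (Fin n)) (i : Fin m) :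
    pullback f x i = x (f i) := rfl

/-- The action of permutations on `ℝⁿ` by `(σ x) i = x (σ⁻¹ i)`. -/
def permAction (n : ℕ) : Representation ℝ (Equiv.Perm (Fin n)) (EuclideanSpace ℝ (Fin n)) where
  toFun σ := pullback ⇑σ⁻¹
  map_one' := rfl
  map_mul' σ τ := by
    rw [mul_inv_rev]
    rfl

theorem permAction_apply {n : ℕ} (σ : Equiv.Perm (Fin n)) (x : EuclideanSpace ℝ (Fin n))
    (i : Fin n) : permAction n σ x i = x (σ⁻¹ i) := rfl

theorem permAction_inner (n : ℕ) (σ : Equiv.Perm (Fin n)) (x y : EuclideanSpace ℝ (Fin n)) :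
    inner ℝ (permAction n σ x) (permAction n σ y) = inner ℝ x y := by
  simp only [PiLp.inner_apply, permAction_apply]
  exact Equiv.sum_comp σ⁻¹ fun i => inner ℝ (x i) (y i)

/-- `S_n ⊆ S_N` for `n ≤ N`: a permutation of the first `n` letters fixing the others. -/
def zeroPadEmb {n N : ℕ} (h : n ≤ N) : Equiv.Perm (Fin n) →* Equiv.Perm (Fin N) :=
  Equiv.Perm.extendDomainHom (Fin.castLEquiv h)

theorem zeroPadEmb_lt {n N : ℕ} (h : n ≤ N) (g : Equiv.Perm (Fin n)) (i : Fin N)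
    (hi : (i : ℕ) < n) : zeroPadEmb h g i = Fin.castLE h (g ⟨i, hi⟩) :=
  Equiv.Perm.extendDomain_apply_subtype g (Fin.castLEquiv h) (b := i) hi

theorem zeroPadEmb_ge {n N : ℕ} (h : n ≤ N) (g : Equiv.Perm (Fin n)) (i : Fin N)
    (hi : ¬ (i : ℕ) < n) : zeroPadEmb h g i = i :=
  Equiv.Perm.extendDomain_apply_not_subtype g (Fin.castLEquiv h) hi

theorem zeroPadEmb_zeroPadEmb {n N M : ℕ} (h : n ≤ N) (h' : N ≤ M) (g : Equiv.Perm (Fin n)) :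
    zeroPadEmb h' (zeroPadEmb h g) = zeroPadEmb (h.trans h') g := by
  ext i
  by_cases hn : (i : ℕ) < n
  · have hN : (i : ℕ) < N := lt_of_lt_of_le hn h
    rw [zeroPadEmb_lt _ _ _ hN, zeroPadEmb_lt _ _ ⟨i, hN⟩ hn, zeroPadEmb_lt _ _ _ hn]
    rfl
  · rw [zeroPadEmb_ge (h.trans h') _ _ hn]
    by_cases hN : (i : ℕ) < N
    · rw [zeroPadEmb_lt _ _ _ hN, zeroPadEmb_ge _ _ ⟨i, hN⟩ hn]
      rfl
    · rw [zeroPadEmb_ge _ _ _ hN]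

/-- Zero-padding `ζ(x) = (x, 0)`. -/
def zeroPad (n N : ℕ) : EuclideanSpace ℝ (Fin n) →ₗ[ℝ] EuclideanSpace ℝ (Fin N) where
  toFun x := WithLp.toLp 2 fun i => if h : (i : ℕ) < n then x ⟨i, h⟩ else 0
  map_add' x y := by
    ext i
    by_cases h : (i : ℕ) < n <;> simp [h]
  map_smul' c x := by
    ext i
    by_cases h : (i : ℕ) < n <;> simp [h]

theorem zeroPad_apply {n N : ℕ} (x : EuclideanSpace ℝ (Fin n)) (i : Fin N) :
    zeroPad n N x i = if h : (i : ℕ) < n then x ⟨i, h⟩ else 0 := rfl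

theorem zeroPad_injective {n N : ℕ} (h : n ≤ N) : Function.Injective (zeroPad n N) := by
  intro x y hxy
  ext i
  have := congrArg (fun z : EuclideanSpace ℝ (Fin N) => z (Fin.castLE h i)) hxy
  simpa [zeroPad_apply] using this

theorem zeroPad_self (n : ℕ) : zeroPad n n = LinearMap.id := by
  ext x i
  simp [zeroPad_apply]

theorem zeroPad_comp {n N M : ℕ} (h : n ≤ N) : zeroPad N M ∘ₗ zeroPad n N = zeroPad n M := by
  refine LinearMap.ext fun x => PiLp.ext fun i => ?_
  simp only [LinearMap.comp_apply, zeroPad_apply]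
  by_cases hn : (i : ℕ) < n
  · have hN : (i : ℕ) < N := lt_of_lt_of_le hn h
    simp [hn, hN]
  · simp [hn]

theorem zeroPad_equivariant {n N : ℕ} (h : n ≤ N) (g : Equiv.Perm (Fin n)) :
    zeroPad n N ∘ₗ permAction n g = permAction N (zeroPadEmb h g) ∘ₗ zeroPad n N := by
  refine LinearMap.ext fun x => PiLp.ext fun i => ?_
  simp only [LinearMap.comp_apply, zeroPad_apply, permAction_apply]
  rw [← map_inv]
  by_cases hn : (i : ℕ) < n
  · generalize hj : zeroPadEmb h g⁻¹ i = j
    rw [zeroPadEmb_lt h g⁻¹ i hn] at hj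
    subst hj
    simp [hn]
  · generalize hj : zeroPadEmb h g⁻¹ i = j
    rw [zeroPadEmb_ge h g⁻¹ i hn] at hj
    subst hj
    simp [hn]

/-- The consistent sequence of the spaces `ℝⁿ` under zero-padding, indexed by `(ℕ, ≤)`. -/
def zeroPadding : ConsistentSequence fun n => EuclSpace.std n where
  order := inferInstance
  directed n m := ⟨max n m, le_max_left _ _, le_max_right _ _⟩
  emb h := zeroPadEmb h
  emb_injective _ := Equiv.Perm.extendDomainHom_injective _
  emb_emb h h' g := zeroPadEmb_zeroPadEmb h h' g
  action n := permAction n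
  action_inner n := permAction_inner n
  φ {n N} _ := zeroPad n N
  φ_injective h := zeroPad_injective h
  φ_self n := zeroPad_self n
  φ_comp h _ := zeroPad_comp h
  φ_equivariant h g := zeroPad_equivariant h g

/-- The equipartition `[N] → [n]`, for `n ∣ N`, into consecutive blocks of size `N / n`. -/
def blockIndex {n N : ℕ+} (h : n ∣ N) (i : Fin N) : Fin n :=
  ⟨i / (N / n : ℕ), Nat.div_lt_of_lt_mul (by
    rw [Nat.div_mul_cancel (PNat.dvd_iff.mp h)]; exact i.2)⟩

/-- Letters of `[N]` as pairs of a block and a position in the block. -/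
def blockEquiv {n N : ℕ+} (h : n ∣ N) : Fin n × Fin (N / n : ℕ) ≃ Fin N :=
  finProdFinEquiv.trans (finCongr (Nat.mul_div_cancel' (PNat.dvd_iff.mp h)))

theorem blockEquiv_symm_fst {n N : ℕ+} (h : n ∣ N) (i : Fin N) :
    ((blockEquiv h).symm i).1 = blockIndex h i := rfl

/-- `S_n ⊆ S_N` for `n ∣ N`: the permutation `g ⊗ I_{N/n}` of the blocks. -/
def blockEmb {n N : ℕ+} (h : n ∣ N) : Equiv.Perm (Fin n) →* Equiv.Perm (Fin N) where
  toFun g := (blockEquiv h).permCongr (g.prodCongr (Equiv.refl _))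
  map_one' := by
    ext i
    simp [Equiv.permCongr_apply]
  map_mul' g g' := by
    ext i
    simp [Equiv.permCongr_apply, Prod.map]

theorem blockEmb_val {n N : ℕ+} (h : n ∣ N) (g : Equiv.Perm (Fin n)) (i : Fin N) :
    ((blockEmb h g i : Fin N) : ℕ) =
      i % (N / n : ℕ) + (N / n : ℕ) * (g (blockIndex h i) : ℕ) := rfl

theorem blockIndex_blockEmb {n N : ℕ+} (h : n ∣ N) (g : Equiv.Perm (Fin n)) (i : Fin N) :
    blockIndex h (blockEmb h g i) = g (blockIndex h i) := by
  rw [← blockEquiv_symm_fst, ← blockEquiv_symm_fst]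
  simp [blockEmb, Equiv.permCongr_apply]

theorem blockIndex_surjective {n N : ℕ+} (h : n ∣ N) : Function.Surjective (blockIndex h) := by
  intro j
  have hpos : 0 < (N / n : ℕ) := Nat.div_pos (PNat.le_of_dvd h) n.pos
  refine ⟨blockEquiv h (j, ⟨0, hpos⟩), ?_⟩
  rw [← blockEquiv_symm_fst, Equiv.symm_apply_apply]

theorem blockSize_mul {n N M : ℕ+} (h : n ∣ N) (h' : N ∣ M) :
    (M / n : ℕ) = (M / N : ℕ) * (N / n : ℕ) := by
  apply Nat.div_eq_of_eq_mul_right n.pos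
  rw [mul_left_comm, Nat.mul_div_cancel' (PNat.dvd_iff.mp h), mul_comm,
    Nat.mul_div_cancel' (PNat.dvd_iff.mp h')]

theorem blockIndex_blockIndex {n N M : ℕ+} (h : n ∣ N) (h' : N ∣ M) (i : Fin M) :
    blockIndex h (blockIndex h' i) = blockIndex (h.trans h') i := by
  ext
  change (i : ℕ) / _ / _ = (i : ℕ) / _
  rw [Nat.div_div_eq_div_mul, blockSize_mul h h']

theorem blockEmb_injective {n N : ℕ+} (h : n ∣ N) : Function.Injective (blockEmb h) := by
  intro g g' hg
  ext j
  obtain ⟨i, rfl⟩ := blockIndex_surjective h j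
  rw [← blockIndex_blockEmb, ← blockIndex_blockEmb, hg]

theorem blockEmb_blockEmb {n N M : ℕ+} (h : n ∣ N) (h' : N ∣ M) (g : Equiv.Perm (Fin n)) :
    blockEmb h' (blockEmb h g) = blockEmb (h.trans h') g := by
  ext i
  simp only [blockEmb_val]
  rw [blockIndex_blockIndex h h', blockSize_mul h h', Nat.mod_mul]
  change _ + _ * ((i : ℕ) / _ % _ + _) = _
  ring

/-- Duplication of entries `δ(x) = (x₁, …, x₁, …, x_n, …, x_n)`, each `N / n` times. -/
def duplicate {n N : ℕ+} (h : n ∣ N) :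
    EuclideanSpace ℝ (Fin n) →ₗ[ℝ] EuclideanSpace ℝ (Fin N) :=
  pullback (blockIndex h)

theorem duplicate_injective {n N : ℕ+} (h : n ∣ N) : Function.Injective (duplicate h) := by
  intro x y hxy
  refine PiLp.ext fun j => ?_
  obtain ⟨i, rfl⟩ := blockIndex_surjective h j
  exact congrArg (fun z : EuclideanSpace ℝ (Fin N) => z i) hxy

theorem duplicate_self (n : ℕ+) : duplicate (dvd_refl n) = LinearMap.id := by
  refine LinearMap.ext fun x => PiLp.ext fun i => congrArg x ?_
  ext
  simp [blockIndex, Nat.div_self n.pos]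

theorem duplicate_comp {n N M : ℕ+} (h : n ∣ N) (h' : N ∣ M) :
    duplicate h' ∘ₗ duplicate h = duplicate (h.trans h') :=
  LinearMap.ext fun x => PiLp.ext fun i => congrArg x (blockIndex_blockIndex h h' i)

theorem duplicate_equivariant {n N : ℕ+} (h : n ∣ N) (g : Equiv.Perm (Fin n)) :
    duplicate h ∘ₗ permAction n g = permAction N (blockEmb h g) ∘ₗ duplicate h := by
  refine LinearMap.ext fun x => PiLp.ext fun i => congrArg x ?_
  rw [← map_inv, blockIndex_blockEmb]

/-- The positive integers partially ordered by divisibility. -/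
@[reducible]
def divisibilityOrder : PartialOrder ℕ+ where
  le n N := n ∣ N
  lt n N := n ∣ N ∧ ¬ N ∣ n
  le_refl := dvd_refl
  le_trans _ _ _ := dvd_trans
  le_antisymm _ _ := PNat.dvd_antisymm

/-- The consistent sequence of the spaces `ℝⁿ` under duplication of entries, indexed by
`(ℕ, · ∣ ·)`. -/
def duplication : ConsistentSequence fun n => EuclSpace.std n where
  order := divisibilityOrder
  directed n m := ⟨n * m, dvd_mul_right n m, dvd_mul_left m n⟩
  emb h := blockEmb h
  emb_injective h := blockEmb_injective h
  emb_emb h h' g := blockEmb_blockEmb h h' g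
  action n := permAction n
  action_inner n := permAction_inner n
  φ h := duplicate h
  φ_injective h := duplicate_injective h
  φ_self n := duplicate_self n
  φ_comp h h' := duplicate_comp h h'
  φ_equivariant h g := duplicate_equivariant h g

/-! ### Free invariants -/

namespace ConsistentSequence

variable {V : ℕ+ → EuclSpace} (S : ConsistentSequence V)

/-- The index set `ℕ` (positive integers) with the partial order of `S`. -/
def Index (_S : ConsistentSequence V) : Type := ℕ+

/-- The integer underlying an index. -/
def Index.val {S : ConsistentSequence V} (n : S.Index) : ℕ+ := n

/-- An integer as an index. -/
def index (n : ℕ+) : S.Index := n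

instance : PartialOrder S.Index := S.order

instance : DecidableEq S.Index := inferInstanceAs (DecidableEq ℕ+)

/-- The invariants of `S_n` in `V n`. -/
def invariants (n : ℕ+) : Submodule ℝ (V n) := (S.action n).invariants

/-- The Reynolds operator `sym_{S_n} = |S_n|⁻¹ ∑ g`. -/
def reynolds (n : ℕ+) : V n →ₗ[ℝ] V n :=
  (Fintype.card (Equiv.Perm (Fin n)) : ℝ)⁻¹ • ∑ g, S.action n g

theorem reynolds_mem (n : ℕ+) (x : V n) : S.reynolds n x ∈ S.invariants n := by
  intro g
  simp only [reynolds, LinearMap.smul_apply, LinearMap.sum_apply, map_smul, map_sum]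
  congr 1
  refine Eq.trans (Finset.sum_congr rfl fun g' _ => ?_)
    (Equiv.sum_comp (Equiv.mulLeft g) fun g' => S.action n g' x)
  rw [Equiv.coe_mulLeft, map_mul]
  rfl

/-- The map `sym_N = sym_{S_N} φ_{N,n}` from invariants of `V n` to invariants of `V N`. -/
def symMap {n N : ℕ+} (h : S.order.le n N) : S.invariants n →ₗ[ℝ] S.invariants N :=
  (S.reynolds N ∘ₗ S.φ h ∘ₗ (S.invariants n).subtype).codRestrict (S.invariants N)
    fun _ => S.reynolds_mem N _

/-- The space of freely-symmetrized elements: the direct limit of the spaces of invariants along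
the maps `sym_N`. -/
abbrev FreelySymmetrized : Type :=
  Module.DirectLimit (fun n : S.Index => S.invariants n.val)
    (fun n N (h : n ≤ N) => S.symMap (n := n.val) (N := N.val) h)

/-- The class `(sym_n v)_{n ⪰ k}` of an invariant `v` of `V k`. -/
def toFreelySymmetrized (k : ℕ+) : S.invariants k →ₗ[ℝ] S.FreelySymmetrized :=
  Module.DirectLimit.of ℝ S.Index (fun n : S.Index => S.invariants n.val)
    (fun n N (h : n ≤ N) => S.symMap (n := n.val) (N := N.val) h) (S.index k)

/-- The space of freely-described elements: sequences of invariants projecting onto each other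
under the adjoints of the embeddings. -/
def freelyDescribed : Submodule ℝ (∀ n, V n) where
  carrier := {v | (∀ n, v n ∈ S.invariants n) ∧
    ∀ (n N : ℕ+) (h : S.order.le n N), LinearMap.adjoint (S.φ h) (v N) = v n}
  add_mem' := by
    rintro a b ⟨ha, ha'⟩ ⟨hb, hb'⟩
    refine ⟨fun n => (S.invariants n).add_mem (ha n) (hb n), fun n N h => ?_⟩
    rw [Pi.add_apply, map_add, ha' n N h, hb' n N h, Pi.add_apply]
  zero_mem' := ⟨fun n => (S.invariants n).zero_mem, fun n N h => map_zero _⟩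
  smul_mem' := by
    rintro c a ⟨ha, ha'⟩
    refine ⟨fun n => (S.invariants n).smul_mem c (ha n), fun n N h => ?_⟩
    rw [Pi.smul_apply, map_smul, ha' n N h, Pi.smul_apply]

end ConsistentSequence

/-! ### FS-pairs and de Finetti maps -/

/-- An FS-pair: `(U, L) = (F(D), F(Z))` or `(U, L) = (F(Z), F(D))` for a construction `F`, where
`Z` is zero-padding and `D` is duplication. -/
inductive FSPair where
  | duplicationOverZeroPadding (F : Construction) : FSPair
  | zeroPaddingOverDuplication (F : Construction) : FSPair

namespace FSPair

/-- The construction `F` of the pair. -/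
def construction : FSPair → Construction
  | duplicationOverZeroPadding F => F
  | zeroPaddingOverDuplication F => F

/-- The common underlying sequence of spaces. -/
abbrev V (P : FSPair) (n : ℕ+) : EuclSpace := P.construction.obj (EuclSpace.std n)

/-- The first member `U` of the pair `(U, L)`. -/
def U : (P : FSPair) → ConsistentSequence P.V
  | duplicationOverZeroPadding F => F.apply duplication
  | zeroPaddingOverDuplication F => F.apply zeroPadding

/-- The second member `L` of the pair `(U, L)`. -/
def L : (P : FSPair) → ConsistentSequence P.V
  | duplicationOverZeroPadding F => F.apply zeroPadding
  | zeroPaddingOverDuplication F => F.apply duplication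

/-- The sample space of the de Finetti map `L_{k,n}`, carrying the uniform distribution: maps
`[k] → [n]` if `U = F(D)`, and maps `[n] → [k]` if `U = F(Z)`. -/
def Sample : FSPair → ℕ+ → ℕ+ → Type
  | duplicationOverZeroPadding _, k, n => Fin k → Fin n
  | zeroPaddingOverDuplication _, k, n => Fin n → Fin k

instance : (P : FSPair) → (k n : ℕ+) → Fintype (P.Sample k n)
  | duplicationOverZeroPadding _, k, n => inferInstanceAs (Fintype (Fin k → Fin n))
  | zeroPaddingOverDuplication _, k, n => inferInstanceAs (Fintype (Fin n → Fin k))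

/-- The de Finetti map `L_{k,n} : V n → V k` at a sample point `f`: it is `ρ(f)` if `U = F(D)`,
and `ρ(f)⋆` if `U = F(Z)`, where `ρ(f)` on the spaces of the pair is obtained by applying the
construction to `ρ(f)` on the spaces `ℝⁿ`. -/
def deFinettiMap : (P : FSPair) → (k n : ℕ+) → P.Sample k n → (P.V n →ₗ[ℝ] P.V k)
  | duplicationOverZeroPadding F, k, n => fun f : Fin k → Fin n => F.map (pullback f)
  | zeroPaddingOverDuplication F, k, n =>
    fun f : Fin n → Fin k => LinearMap.adjoint (F.map (pullback f))

/-- The expectation `𝔼 L_{k,n}⋆ v`. -/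
def expectedAdjoint (P : FSPair) (k n : ℕ+) (v : P.V k) : P.V n :=
  (Fintype.card (P.Sample k n) : ℝ)⁻¹ •
    ∑ f : P.Sample k n, LinearMap.adjoint (P.deFinettiMap k n f) v

end FSPair

end

/-! ### Constructions and adjoints -/

namespace EuclSpace

/-! For `f : [m] → [n]` let `F(f)` be the construction applied to the push-forward `e i ↦ e (f i)`.
Since constructions commute with adjoints, permutations and zero-paddings are maps `F(f)`, and
duplications are adjoints of such maps. The map `v ↦ 𝔼 L_{k,n}⋆ v` is the average of `F(f)` over all
`f` (`avgPush`) when `U = F(D)`, and the adjoint of such an average when `U = F(Z)`.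

Compatibility is a fact about uniform random maps: restricting one to an initial segment, or
composing it with an equipartition, gives a uniform random map again. Hence the averages descend to
the direct limit and land in freely-described elements.

Injectivity needs only the square case `n = k`. Split `F(ℝⁿ)` by exact support (`crossEffect`). A
push-forward along `f` sends support `T` to support `f(T)`, so support sizes never grow. On the top
layer of an invariant vector only the `f` injective on `T` preserve the size, and these act like
permutations. After symmetrization, the average multiplies this layer by a positive number, so a
vector in the kernel has no top layer (`eq_zero_of_avgPush_eq_zero`). The adjoint case follows
because an injective endomorphism of the finite-dimensional space of invariants is surjective.

Surjectivity is a dimension count. Pairing embeds `lim U` into the dual of `colim U`, for `U` either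
`F(D)` or `F(Z)`. With injectivity for both pairs this gives `dim colim F(Z) ≤ dim lim F(D) ≤ dim
colim F(D) ≤ dim lim F(Z) ≤ dim colim F(Z)`. The chain is finite because `F` has bounded polynomial
degree: supports have bounded size, so every invariant is symmetrized from a fixed `F(ℝᵈ)`. -/

theorem frobenius_map_left {k : ℕ} {X Y : EuclSpace} {T : X →ₗ[ℝ] Y} {T' : Y →ₗ[ℝ] X}
    (hT : ∀ x y, inner ℝ (T x) y = inner ℝ x (T' y)) (s : TensorPow k X) (t : TensorPow k Y) :
    frobenius k Y (PiTensorProduct.map (fun _ => T) s) t =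
      frobenius k X s (PiTensorProduct.map (fun _ => T') t) := by
  induction s using PiTensorProduct.induction_on with
  | smul_tprod r x =>
    induction t using PiTensorProduct.induction_on with
    | smul_tprod r' y => simp [PiTensorProduct.map_tprod, frobenius_tprod, hT]
    | add t t' h h' => simp only [map_add, h, h']
  | add s s' h h' => simp only [map_add, LinearMap.add_apply, h, h']

end EuclSpace

namespace Construction

/-- Being an adjoint pair is inherited by each operation, so structural induction applies. -/
theorem inner_map_left (F : Construction) {X Y : EuclSpace} {T : X →ₗ[ℝ] Y} {T' : Y →ₗ[ℝ] X}
    (hT : ∀ x y, inner ℝ (T x) y = inner ℝ x (T' y)) (x : F.obj X) (y : F.obj Y) :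
    inner ℝ (F.map T x) y = inner ℝ x (F.map T' y) := by
  induction F with
  | id => exact hT x y
  | prod F G hF hG => exact congrArg₂ (· + ·) (hF _ _) (hG _ _)
  | tensor F G hF hG =>
    have h1 : F.map T' = LinearMap.adjoint (F.map T) :=
      (LinearMap.eq_adjoint_iff _ _).2 fun a b => by
        rw [real_inner_comm, ← hF, real_inner_comm]
    have h2 : G.map T' = LinearMap.adjoint (G.map T) :=
      (LinearMap.eq_adjoint_iff _ _).2 fun a b => by
        rw [real_inner_comm, ← hG, real_inner_comm]
    change inner ℝ (TensorProduct.map (F.map T) (G.map T) x) y =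
      inner ℝ x (TensorProduct.map (F.map T') (G.map T') y)
    rw [h1, h2, ← TensorProduct.adjoint_map]
    exact (LinearMap.adjoint_inner_right (TensorProduct.map (F.map T) (G.map T)) x y).symm
  | sym k F hF => exact EuclSpace.frobenius_map_left hF _ _

theorem adjoint_map (F : Construction) {X Y : EuclSpace} (T : X →ₗ[ℝ] Y) :
    LinearMap.adjoint (F.map T) = F.map (LinearMap.adjoint T) :=
  ((LinearMap.eq_adjoint_iff _ _).2 fun a b => by
    rw [real_inner_comm,
      ← F.inner_map_left (fun x y => (LinearMap.adjoint_inner_right T x y).symm),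
      real_inner_comm]).symm

end Construction

/-! ### Push-forwards and coordinate projections -/

/-- The linear map `ρ(f)⋆ : ℝᵐ → ℝⁿ`, `e i ↦ e (f i)`, of a map `f : [m] → [n]`. -/
noncomputable def pushforward {m n : ℕ} (f : Fin m → Fin n) :
    EuclideanSpace ℝ (Fin m) →ₗ[ℝ] EuclideanSpace ℝ (Fin n) :=
  LinearMap.adjoint (pullback f)

theorem adjoint_pushforward {m n : ℕ} (f : Fin m → Fin n) :
    LinearMap.adjoint (pushforward f) = pullback f :=
  LinearMap.adjoint_adjoint _

theorem pushforward_comp {l m n : ℕ} (f : Fin m → Fin n) (g : Fin l → Fin m) :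
    pushforward (f ∘ g) = pushforward f ∘ₗ pushforward g :=
  LinearMap.adjoint_comp (pullback g) (pullback f)

theorem pushforward_perm {n : ℕ} (σ : Equiv.Perm (Fin n)) :
    pushforward σ = permAction n σ := by
  refine ((LinearMap.eq_adjoint_iff _ _).2 fun x y => ?_).symm
  simp only [PiLp.inner_apply, permAction_apply, pullback_apply]
  rw [← Equiv.sum_comp σ]
  simp

/-- Puts zero-padding in the same functorial language as duplication, which is by definition a
pull-back. -/
theorem pushforward_castLE {n N : ℕ} (h : n ≤ N) :
    pushforward (Fin.castLE h) = zeroPad n N := by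
  refine ((LinearMap.eq_adjoint_iff _ _).2 fun x y => ?_).symm
  obtain ⟨m, rfl⟩ := Nat.exists_eq_add_of_le h
  simp only [PiLp.inner_apply, zeroPad_apply, pullback_apply, Fin.sum_univ_add]
  simp
  rfl

/-- The coordinate projection of `ℝⁿ` onto the coordinates in `S`. -/
def coordProj {n : ℕ} (S : Finset (Fin n)) : EuclideanSpace ℝ (Fin n) →ₗ[ℝ] EuclideanSpace ℝ (Fin n) where
  toFun x := WithLp.toLp 2 fun i => if i ∈ S then x i else 0
  map_add' x y := by
    ext i
    by_cases h : i ∈ S <;> simp [h]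
  map_smul' c x := by
    ext i
    by_cases h : i ∈ S <;> simp [h]

theorem coordProj_apply {n : ℕ} (S : Finset (Fin n)) (x : EuclideanSpace ℝ (Fin n)) (i : Fin n) :
    coordProj S x i = if i ∈ S then x i else 0 := rfl

theorem adjoint_coordProj {n : ℕ} (S : Finset (Fin n)) :
    LinearMap.adjoint (coordProj S) = coordProj S := by
  refine ((LinearMap.eq_adjoint_iff _ _).2 fun x y => ?_).symm
  simp only [PiLp.inner_apply, coordProj_apply]
  refine Finset.sum_congr rfl fun i _ => ?_
  split_ifs <;> simp

theorem coordProj_univ (n : ℕ) : coordProj (Finset.univ : Finset (Fin n)) = LinearMap.id := by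
  ext x i
  simp [coordProj_apply]

theorem coordProj_comp {n : ℕ} (S T : Finset (Fin n)) :
    coordProj S ∘ₗ coordProj T = coordProj (S ∩ T) := by
  ext x i
  by_cases h : i ∈ S <;> simp [coordProj_apply, h]

theorem coordProj_comp_pushforward {m n : ℕ} (f : Fin m → Fin n) (S : Finset (Fin n)) :
    coordProj S ∘ₗ pushforward f = pushforward f ∘ₗ coordProj {i | f i ∈ S} := by
  -- Taking adjoints turns push-forwards into pull-backs, which are given pointwise.
  apply LinearMap.adjoint.injective
  rw [LinearMap.adjoint_comp, LinearMap.adjoint_comp, adjoint_coordProj, adjoint_coordProj,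
    adjoint_pushforward]
  ext x i
  simp [coordProj_apply, pullback_apply]

theorem pushforward_comp_coordProj_congr {m n : ℕ} {f g : Fin m → Fin n} {S : Finset (Fin m)}
    (h : ∀ i ∈ S, f i = g i) :
    pushforward f ∘ₗ coordProj S = pushforward g ∘ₗ coordProj S := by
  apply LinearMap.adjoint.injective
  rw [LinearMap.adjoint_comp, LinearMap.adjoint_comp, adjoint_coordProj,
    adjoint_pushforward, adjoint_pushforward]
  ext x i
  by_cases hi : i ∈ S <;> simp [coordProj_apply, pullback_apply, hi, h]

theorem coordProj_eq_sum {n : ℕ} (T : Finset (Fin n)) :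
    coordProj T = ∑ i, if {i} ⊆ T then coordProj {i} else 0 := by
  refine LinearMap.ext fun x => PiLp.ext fun i => ?_
  have : ∀ j, (if {j} ⊆ T then coordProj {j} else 0 :
      EuclideanSpace ℝ (Fin n) →ₗ[ℝ] EuclideanSpace ℝ (Fin n)) x i
        = if i = j then (if i ∈ T then x i else 0) else 0 := by
    intro j
    by_cases hij : i = j
    · subst hij
      by_cases hi : i ∈ T <;> simp [hi, coordProj_apply]
    · by_cases hi : j ∈ T <;> simp [hi, coordProj_apply, hij]
  simp only [LinearMap.sum_apply, WithLp.ofLp_sum, Finset.sum_apply, this, coordProj_apply]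
  simp

namespace Construction

variable (F : Construction)

/-- The construction applied to a push-forward. -/
noncomputable def push {m n : ℕ} (f : Fin m → Fin n) :
    F.obj (EuclSpace.std m) →ₗ[ℝ] F.obj (EuclSpace.std n) :=
  F.map (X := EuclSpace.std m) (Y := EuclSpace.std n) (pushforward f)

theorem push_comp {l m n : ℕ} (f : Fin m → Fin n) (g : Fin l → Fin m) :
    F.push (f ∘ g) = F.push f ∘ₗ F.push g :=
  (congrArg F.map (pushforward_comp f g)).trans (F.map_comp _ _)

theorem push_push {l m n : ℕ} (f : Fin m → Fin n) (g : Fin l → Fin m)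
    (x : F.obj (EuclSpace.std l)) : F.push f (F.push g x) = F.push (f ∘ g) x :=
  (LinearMap.congr_fun (F.push_comp f g) x).symm

/-- The construction applied to a coordinate projection. -/
noncomputable def proj {n : ℕ} (S : Finset (Fin n)) :
    F.obj (EuclSpace.std n) →ₗ[ℝ] F.obj (EuclSpace.std n) :=
  F.map (X := EuclSpace.std n) (Y := EuclSpace.std n) (coordProj S)

theorem proj_univ (n : ℕ) : F.proj (Finset.univ : Finset (Fin n)) = LinearMap.id :=
  (congrArg F.map (coordProj_univ n)).trans (F.map_id _)

theorem proj_comp {n : ℕ} (S T : Finset (Fin n)) :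
    F.proj S ∘ₗ F.proj T = F.proj (S ∩ T) :=
  (F.map_comp _ _).symm.trans (congrArg F.map (coordProj_comp S T))

theorem proj_comp_push {m n : ℕ} (f : Fin m → Fin n) (S : Finset (Fin n)) :
    F.proj S ∘ₗ F.push f = F.push f ∘ₗ F.proj {i | f i ∈ S} :=
  (F.map_comp _ _).symm.trans
    ((congrArg F.map (coordProj_comp_pushforward f S)).trans (F.map_comp _ _))

theorem push_comp_proj_congr {m n : ℕ} {f g : Fin m → Fin n} {S : Finset (Fin m)}
    (h : ∀ i ∈ S, f i = g i) : F.push f ∘ₗ F.proj S = F.push g ∘ₗ F.proj S :=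
  (F.map_comp _ _).symm.trans
    ((congrArg F.map (pushforward_comp_coordProj_congr h)).trans (F.map_comp _ _))

end Construction

/-! ### Möbius decomposition -/

/-- The Möbius transform of a function on finite sets. -/
def moebiusTransform {α M : Type*} [DecidableEq α] [AddCommGroup M] (e : Finset α → M)
    (S : Finset α) : M :=
  e S - ∑ T ∈ S.ssubsets.attach, moebiusTransform e T.1
termination_by S.card
decreasing_by exact Finset.card_lt_card (Finset.mem_ssubsets.1 T.2)

theorem sum_moebiusTransform {α M : Type*} [DecidableEq α] [AddCommGroup M] (e : Finset α → M)
    (S : Finset α) : ∑ T ∈ S.powerset, moebiusTransform e T = e S := by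
  rw [← Finset.insert_erase (Finset.mem_powerset_self S),
    Finset.sum_insert (Finset.notMem_erase _ _), moebiusTransform,
    Finset.sum_attach S.ssubsets (moebiusTransform e)]
  exact sub_add_cancel _ _

/-- Uniqueness of Möbius inversion, by cancelling proper subsets. Identities between cross effects
are checked through it on the simpler projections. -/
theorem eq_of_sum_powerset_eq {α M : Type*} [DecidableEq α] [AddCommGroup M]
    {c c' : Finset α → M} (h : ∀ S : Finset α, ∑ T ∈ S.powerset, c T = ∑ T ∈ S.powerset, c' T)
    (S : Finset α) : c S = c' S := by
  induction S using Finset.strongInduction with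
  | H S ih =>
    have := h S
    rw [← Finset.insert_erase (Finset.mem_powerset_self S),
      Finset.sum_insert (Finset.notMem_erase _ _),
      Finset.sum_insert (Finset.notMem_erase _ _),
      show ∑ T ∈ S.powerset.erase S, c T = ∑ T ∈ S.powerset.erase S, c' T from
        Finset.sum_congr rfl fun T hT => ih T (Finset.mem_ssubsets.1 hT)] at this
    exact add_right_cancel this

/-- A function on finite sets whose Möbius transform lives on sets with at most `d` elements. -/
def HasDegreeLE {α M : Type} [DecidableEq α] [AddCommGroup M] (d : ℕ) (e : Finset α → M) : Prop :=
  ∃ (ι : Type) (_ : Fintype ι) (A : ι → Finset α) (m : ι → M), (∀ i, (A i).card ≤ d) ∧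
    ∀ T, e T = ∑ i, if A i ⊆ T then m i else 0

/-! ### Operations on set functions of bounded degree -/

namespace HasDegreeLE

variable {α M N P : Type} [DecidableEq α] [AddCommGroup M] [AddCommGroup N] [AddCommGroup P]
  [Module ℝ M] [Module ℝ N] [Module ℝ P] {d d' : ℕ}

omit [Module ℝ M] in
-- By uniqueness of Möbius inversion, the transform at `S` collects exactly the terms `m i` with `A
-- i = S`.
theorem moebiusTransform_eq_zero {e : Finset α → M} (h : HasDegreeLE d e) {S : Finset α}
    (hS : d < S.card) : moebiusTransform e S = 0 := by
  obtain ⟨ι, _, A, m, hA, he⟩ := h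
  rw [eq_of_sum_powerset_eq (c := moebiusTransform e)
    (c' := fun S => ∑ i, if A i = S then m i else 0) ?_ S]
  · refine Finset.sum_eq_zero fun i _ => if_neg ?_
    rintro rfl
    exact (hA i).not_gt hS
  · intro T
    rw [sum_moebiusTransform, he, Finset.sum_comm]
    refine Finset.sum_congr rfl fun i _ => ?_
    simp [Finset.sum_ite_eq]

omit [Module ℝ M] in
theorem mono {e : Finset α → M} (h : HasDegreeLE d e) (hd : d ≤ d') : HasDegreeLE d' e := by
  obtain ⟨ι, _, A, m, hA, he⟩ := h
  exact ⟨ι, _, A, m, fun i => (hA i).trans hd, he⟩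

omit [Module ℝ M] in
theorem add {e e' : Finset α → M} (h : HasDegreeLE d e) (h' : HasDegreeLE d e') :
    HasDegreeLE d fun T => e T + e' T := by
  obtain ⟨ι, _, A, m, hA, he⟩ := h
  obtain ⟨ι', _, A', m', hA', he'⟩ := h'
  refine ⟨ι ⊕ ι', inferInstance, Sum.elim A A', Sum.elim m m', ?_, fun T => ?_⟩
  · rintro (i | i)
    exacts [hA i, hA' i]
  · simp only [he, he', Fintype.sum_sum_type, Sum.elim_inl, Sum.elim_inr]
    rfl

theorem linear {e : Finset α → M} (h : HasDegreeLE d e) (φ : M →ₗ[ℝ] N) :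
    HasDegreeLE d fun T => φ (e T) := by
  obtain ⟨ι, _, A, m, hA, he⟩ := h
  refine ⟨ι, ‹_›, A, fun i => φ (m i), hA, fun T => ?_⟩
  simp [he, apply_ite φ]

/-- `A ⊆ T` and `A' ⊆ T` together mean `A ∪ A' ⊆ T`, so degrees add when the two sums are expanded.
-/
theorem bilinear {e : Finset α → M} {e' : Finset α → N} (h : HasDegreeLE d e)
    (h' : HasDegreeLE d' e') (φ : M →ₗ[ℝ] N →ₗ[ℝ] P) :
    HasDegreeLE (d + d') fun T => φ (e T) (e' T) := by
  obtain ⟨ι, _, A, m, hA, he⟩ := h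
  obtain ⟨ι', _, A', m', hA', he'⟩ := h'
  refine ⟨ι × ι', inferInstance, fun p => A p.1 ∪ A' p.2, fun p => φ (m p.1) (m' p.2),
    fun p => (Finset.card_union_le _ _).trans (add_le_add (hA _) (hA' _)), fun T => ?_⟩
  rw [Fintype.sum_prod_type]
  simp only [he, he', map_sum, LinearMap.sum_apply]
  rw [Finset.sum_comm]
  refine Finset.sum_congr rfl fun i _ => Finset.sum_congr rfl fun j _ => ?_
  by_cases h1 : A i ⊆ T <;> by_cases h2 : A' j ⊆ T <;> simp [Finset.union_subset_iff, h1, h2]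

theorem multilinear {e : Finset α → M} (h : HasDegreeLE d e) (k : ℕ)
    (φ : MultilinearMap ℝ (fun _ : Fin k => M) N) :
    HasDegreeLE (k * d) fun T => φ fun _ => e T := by
  obtain ⟨ι, _, A, m, hA, he⟩ := h
  refine ⟨Fin k → ι, inferInstance, fun p => Finset.univ.biUnion fun j => A (p j),
    fun p => φ fun j => m (p j), fun p => ?_, fun T => ?_⟩
  · simpa using Finset.card_biUnion_le_card_mul Finset.univ (fun j => A (p j)) d fun j _ => hA _
  · simp only [he]
    rw [MultilinearMap.map_sum φ fun _ i => if A i ⊆ T then m i else 0]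
    refine Finset.sum_congr rfl fun p _ => ?_
    split_ifs with hp
    · rw [Finset.biUnion_subset] at hp
      simp [fun j => hp j (Finset.mem_univ j)]
    · simp only [Finset.biUnion_subset, not_forall] at hp
      obtain ⟨j, _, hj⟩ := hp
      exact φ.map_coord_zero j (if_neg hj)

end HasDegreeLE

namespace Construction

/-- A bound for the degree of a construction as a polynomial functor. -/
def degree : Construction → ℕ
  | id => 1
  | prod F G => max F.degree G.degree
  | tensor F G => F.degree + G.degree
  | sym k F => k * F.degree

/-- This makes `F` a polynomial functor: its components of support larger than `F.degree` vanish. -/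
theorem hasDegreeLE_proj (F : Construction) (n : ℕ) :
    HasDegreeLE F.degree fun S : Finset (Fin n) => F.proj S := by
  induction F with
  | id =>
    refine ⟨Fin n, inferInstance, fun i => {i}, fun i => coordProj {i}, fun i => by
      simp [degree], fun T => coordProj_eq_sum T⟩
  | prod F G hF hG =>
    -- The projection on a product is the sum of its two diagonal blocks, each obtained linearly
    -- from one factor.
    let l := (WithLp.linearEquiv 2 ℝ (F.obj (EuclSpace.std n) × G.obj (EuclSpace.std n)))
    have h1 := ((hF.mono (le_max_left _ G.degree)).linear (LinearMap.lcomp ℝ _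
      (LinearMap.fst ℝ _ _ ∘ₗ l.toLinearMap))).linear (LinearMap.llcomp ℝ _ _ _
        (l.symm.toLinearMap ∘ₗ LinearMap.inl ℝ _ _))
    have h2 := ((hG.mono (le_max_right F.degree _)).linear (LinearMap.lcomp ℝ _
      (LinearMap.snd ℝ _ _ ∘ₗ l.toLinearMap))).linear (LinearMap.llcomp ℝ _ _ _
        (l.symm.toLinearMap ∘ₗ LinearMap.inr ℝ _ _))
    refine (congrArg (HasDegreeLE _) (funext fun T => ?_)).mp (h1.add h2)
    refine LinearMap.ext fun x => ?_
    change l.symm (F.proj T (l x).1, 0) + l.symm (0, G.proj T (l x).2) =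
      l.symm (F.proj T (l x).1, G.proj T (l x).2)
    rw [← map_add, Prod.mk_add_mk, add_zero, zero_add]
  | tensor F G hF hG => exact hF.bilinear hG (TensorProduct.mapBilinear (.id ℝ) _ _ _ _)
  | sym k F hF =>
    -- `Sym^k` is a retract of the `k`-th tensor power, so the degree bound is proved there and
    -- carried back by `r`.
    obtain ⟨r, hr⟩ := (EuclSpace.SymTensor.incl k
      (F.obj (EuclSpace.std n))).exists_leftInverse_of_injective
        (LinearMap.ker_eq_bot.mpr (EuclSpace.SymTensor.incl_injective _ _))
    have h := ((hF.multilinear k (PiTensorProduct.mapMultilinear ℝ _ _)).linear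
      (LinearMap.llcomp ℝ _ _ _ r)).linear
        (LinearMap.lcomp ℝ _ (EuclSpace.SymTensor.incl k (F.obj (EuclSpace.std n))))
    refine (congrArg (HasDegreeLE _) (funext fun T => ?_)).mp h
    exact LinearMap.ext fun x =>
      LinearMap.congr_fun hr (EuclSpace.symMap k (F.proj T) x)

end Construction

namespace LinearMap

variable {ι M N P : Type*} [AddCommGroup M] [AddCommGroup N] [AddCommGroup P]
  [Module ℝ M] [Module ℝ N] [Module ℝ P]

theorem finsetSum_comp (s : Finset ι) (g : ι → N →ₗ[ℝ] P) (f : M →ₗ[ℝ] N) :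
    (∑ i ∈ s, g i) ∘ₗ f = ∑ i ∈ s, g i ∘ₗ f := by
  ext x
  simp

theorem comp_finsetSum (s : Finset ι) (g : N →ₗ[ℝ] P) (f : ι → M →ₗ[ℝ] N) :
    g ∘ₗ (∑ i ∈ s, f i) = ∑ i ∈ s, g ∘ₗ f i := by
  ext x
  simp

end LinearMap

namespace Construction

variable (F : Construction)

/-! ### Cross effects -/

/-- The component of `F(ℝⁿ)` of the tensors whose support is exactly `S`, as a projection. -/
noncomputable def crossEffect {n : ℕ} (S : Finset (Fin n)) :
    F.obj (EuclSpace.std n) →ₗ[ℝ] F.obj (EuclSpace.std n) :=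
  moebiusTransform F.proj S

theorem sum_crossEffect_powerset {n : ℕ} (S : Finset (Fin n)) :
    ∑ T ∈ S.powerset, F.crossEffect T = F.proj S :=
  sum_moebiusTransform _ _

theorem sum_crossEffect_apply {n : ℕ} (x : F.obj (EuclSpace.std n)) :
    ∑ T : Finset (Fin n), F.crossEffect T x = x := by
  rw [← LinearMap.sum_apply, ← Finset.powerset_univ, sum_crossEffect_powerset, proj_univ]
  rfl

theorem crossEffect_eq_zero {n : ℕ} {S : Finset (Fin n)} (hS : F.degree < S.card) :
    F.crossEffect S = 0 :=
  (F.hasDegreeLE_proj n).moebiusTransform_eq_zero hS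

theorem crossEffect_comp_proj {n : ℕ} (S U : Finset (Fin n)) :
    F.crossEffect S ∘ₗ F.proj U = if S ⊆ U then F.crossEffect S else 0 := by
  refine eq_of_sum_powerset_eq (c := fun S => F.crossEffect S ∘ₗ F.proj U)
    (c' := fun S => if S ⊆ U then F.crossEffect S else 0) (fun V => ?_) S
  rw [← Finset.sum_filter, ← LinearMap.finsetSum_comp, sum_crossEffect_powerset, proj_comp,
    ← sum_crossEffect_powerset]
  refine Finset.sum_congr ?_ fun _ _ => rfl
  ext T
  simp only [Finset.mem_filter, Finset.mem_powerset, Finset.subset_inter_iff]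

theorem proj_comp_crossEffect {n : ℕ} (S U : Finset (Fin n)) :
    F.proj U ∘ₗ F.crossEffect S = if S ⊆ U then F.crossEffect S else 0 := by
  refine eq_of_sum_powerset_eq (c := fun S => F.proj U ∘ₗ F.crossEffect S)
    (c' := fun S => if S ⊆ U then F.crossEffect S else 0) (fun V => ?_) S
  rw [← Finset.sum_filter, ← LinearMap.comp_finsetSum, sum_crossEffect_powerset, proj_comp,
    ← sum_crossEffect_powerset]
  refine Finset.sum_congr ?_ fun _ _ => rfl
  ext T
  simp only [Finset.mem_filter, Finset.mem_powerset, Finset.subset_inter_iff, and_comm]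

/-- The cross effects are mutually annihilating idempotents; they sum to the identity, so they
decompose the space by exact support. -/
theorem crossEffect_comp_crossEffect {n : ℕ} (S T : Finset (Fin n)) :
    F.crossEffect S ∘ₗ F.crossEffect T = if S = T then F.crossEffect S else 0 := by
  refine eq_of_sum_powerset_eq (c := fun T => F.crossEffect S ∘ₗ F.crossEffect T)
    (c' := fun T => if S = T then F.crossEffect S else 0) (fun V => ?_) T
  rw [← LinearMap.comp_finsetSum, sum_crossEffect_powerset, crossEffect_comp_proj]
  simp

/-- Summed over the subsets of `V`, both sides become the rule that projecting to `V` after `f` is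
projecting to the preimage of `V` before `f`. -/
theorem crossEffect_comp_push {m n : ℕ} (f : Fin m → Fin n) (S : Finset (Fin n)) :
    F.crossEffect S ∘ₗ F.push f = ∑ T with T.image f = S, F.push f ∘ₗ F.crossEffect T := by
  refine eq_of_sum_powerset_eq (c := fun S => F.crossEffect S ∘ₗ F.push f)
    (c' := fun S => ∑ T with T.image f = S, F.push f ∘ₗ F.crossEffect T) (fun V => ?_) S
  rw [← LinearMap.finsetSum_comp, sum_crossEffect_powerset, proj_comp_push,
    ← sum_crossEffect_powerset, LinearMap.comp_finsetSum]
  simp only [Finset.sum_filter]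
  rw [Finset.sum_comm]
  simp only [Finset.sum_ite_eq, Finset.mem_powerset]
  rw [← Finset.sum_filter]
  refine Finset.sum_congr ?_ fun _ _ => rfl
  ext T
  simp [Finset.subset_iff]

theorem crossEffect_push_perm {n : ℕ} (σ : Equiv.Perm (Fin n)) (T : Finset (Fin n))
    (x : F.obj (EuclSpace.std n)) :
    F.crossEffect (T.image σ) (F.push σ x) = F.push σ (F.crossEffect T x) := by
  have h := LinearMap.congr_fun (F.crossEffect_comp_push σ (T.image σ)) x
  rwa [show (Finset.univ.filter fun T' : Finset (Fin n) => T'.image σ = T.image σ) = {T} by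
    ext T'
    simp [(Finset.image_injective σ.injective).eq_iff], Finset.sum_singleton] at h

theorem push_crossEffect_congr {m n : ℕ} {f g : Fin m → Fin n} {S : Finset (Fin m)}
    (h : ∀ i ∈ S, f i = g i) (x : F.obj (EuclSpace.std m)) :
    F.push f (F.crossEffect S x) = F.push g (F.crossEffect S x) := by
  have hS : F.crossEffect S x = F.proj S (F.crossEffect S x) := by
    have := LinearMap.congr_fun (F.proj_comp_crossEffect S S) x
    rw [if_pos subset_rfl] at this
    exact this.symm
  rw [hS]
  exact LinearMap.congr_fun (F.push_comp_proj_congr h) (F.crossEffect S x)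

/-! ### Symmetrization -/

/-- The average of the action of the symmetric group. -/
noncomputable def symmetrize (n : ℕ) : F.obj (EuclSpace.std n) →ₗ[ℝ] F.obj (EuclSpace.std n) :=
  (Fintype.card (Equiv.Perm (Fin n)) : ℝ)⁻¹ • ∑ σ : Equiv.Perm (Fin n), F.push σ

theorem symmetrize_push {n : ℕ} (σ : Equiv.Perm (Fin n)) (x : F.obj (EuclSpace.std n)) :
    F.symmetrize n (F.push σ x) = F.symmetrize n x := by
  simp only [symmetrize, LinearMap.smul_apply, LinearMap.sum_apply, push_push]
  congr 1
  exact Equiv.sum_comp (Equiv.mulRight σ) fun τ : Equiv.Perm (Fin n) => F.push τ x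

theorem symmetrize_eq_self {n : ℕ} {x : F.obj (EuclSpace.std n)}
    (hx : ∀ σ : Equiv.Perm (Fin n), F.push σ x = x) : F.symmetrize n x = x := by
  simp only [symmetrize, LinearMap.smul_apply, LinearMap.sum_apply, hx, Finset.sum_const,
    Finset.card_univ]
  rw [← Nat.cast_smul_eq_nsmul ℝ, smul_smul, inv_mul_cancel₀ (by positivity), one_smul]

theorem exists_perm_eqOn {n : ℕ} {f : Fin n → Fin n} {T : Finset (Fin n)}
    (hf : Set.InjOn f T) : ∃ σ : Equiv.Perm (Fin n), ∀ i ∈ T, f i = σ i := by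
  obtain ⟨g, hg⟩ := (Set.mapsTo_univ f T).mono_right
    (by simp : Set.univ ⊆ ((Finset.univ : Finset (Fin n)) : Set (Fin n)))
    |>.exists_equiv_extend_of_card_eq (by simp) hf
  exact ⟨g.trans (Equiv.subtypeUnivEquiv Finset.mem_univ), fun i hi => (hg i hi).symm⟩

/-- On vectors supported on `T` only `f|_T` matters; being injective, it extends to a permutation,
which symmetrization absorbs. -/
theorem symmetrize_push_crossEffect {n : ℕ} {f : Fin n → Fin n} {T : Finset (Fin n)}
    (hf : Set.InjOn f T) (x : F.obj (EuclSpace.std n)) :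
    F.symmetrize n (F.push f (F.crossEffect T x)) = F.symmetrize n (F.crossEffect T x) := by
  obtain ⟨σ, hσ⟩ := exists_perm_eqOn hf
  rw [F.push_crossEffect_congr hσ, symmetrize_push]

/-- Some permutation carries `S` to `T`, and it fixes `x`: after symmetrization only the size of the
support matters. -/
theorem symmetrize_crossEffect_congr {n : ℕ} {S T : Finset (Fin n)} (h : S.card = T.card)
    {x : F.obj (EuclSpace.std n)} (hx : ∀ σ : Equiv.Perm (Fin n), F.push σ x = x) :
    F.symmetrize n (F.crossEffect S x) = F.symmetrize n (F.crossEffect T x) := by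
  obtain ⟨σ, hσ⟩ : ∃ σ : Equiv.Perm (Fin n), S.image σ = T := by
    let e : {i // i ∈ S} ≃ {i // i ∈ T} := Finset.equivOfCardEq h
    refine ⟨e.extendSubtype, Finset.eq_of_subset_of_card_le ?_ ?_⟩
    · intro i hi
      obtain ⟨j, hj, rfl⟩ := Finset.mem_image.1 hi
      exact e.extendSubtype_mem j hj
    · rw [Finset.card_image_of_injective _ (Equiv.injective _), h]
  rw [← F.symmetrize_push σ (F.crossEffect S x), ← crossEffect_push_perm, hx, hσ]

/-- The average of the maps `F(ρ(f)⋆)` over all maps `f : [m] → [n]`. -/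
noncomputable def avgPush (m n : ℕ) : F.obj (EuclSpace.std m) →ₗ[ℝ] F.obj (EuclSpace.std n) :=
  (Fintype.card (Fin m → Fin n) : ℝ)⁻¹ • ∑ f : Fin m → Fin n, F.push f

/-! ### Injectivity of the average on invariants -/

theorem crossEffect_eq_zero_of_symmetrize {n t : ℕ} {x : F.obj (EuclSpace.std n)}
    (hx : ∀ σ : Equiv.Perm (Fin n), F.push σ x = x)
    (h : ∀ T : Finset (Fin n), T.card = t → F.symmetrize n (F.crossEffect T x) = 0)
    (T : Finset (Fin n)) (hT : T.card = t) : F.crossEffect T x = 0 := by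
  -- The whole size-`t` layer of the invariant `x` is itself invariant, hence equal to its
  -- symmetrization, which vanishes term by term.
  set q := ∑ S ∈ Finset.univ.filter fun S : Finset (Fin n) => S.card = t, F.crossEffect S x with hq
  have hq0 : q = 0 := by
    rw [← F.symmetrize_eq_self (x := q), hq, map_sum]
    · exact Finset.sum_eq_zero fun S hS => h S (Finset.mem_filter.1 hS).2
    · intro σ
      rw [hq, map_sum]
      refine Finset.sum_bij (fun S _ => S.image σ) (fun S hS => ?_) (fun S _ S' _ hSS' => ?_)
        (fun S hS => ?_) fun S _ => ?_
      · simpa [Finset.card_image_of_injective _ σ.injective] using hS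
      · exact Finset.image_injective σ.injective hSS'
      · refine ⟨S.image σ.symm, ?_, ?_⟩
        · simpa [Finset.card_image_of_injective _ σ.symm.injective] using hS
        · simp [Finset.image_image]
      · rw [← crossEffect_push_perm, hx]
  have h1 : F.crossEffect T q = F.crossEffect T x := by
    rw [hq, map_sum, Finset.sum_eq_single T]
    · have := LinearMap.congr_fun (F.crossEffect_comp_crossEffect T T) x
      rwa [if_pos rfl] at this
    · intro S _ hS
      have := LinearMap.congr_fun (F.crossEffect_comp_crossEffect T S) x
      rwa [if_neg hS.symm] at this
    · intro hT'
      simp [hT] at hT'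
  rw [← h1, hq0, map_zero]

/-- Supports larger than `t` are absent from `x`, smaller ones cannot have an image of size `t`, and
on those of size `t` with image of size `t` the map `f` is injective. -/
theorem sum_symmetrize_crossEffect_push {n t : ℕ} {x : F.obj (EuclSpace.std n)}
    (hx : ∀ T : Finset (Fin n), t < T.card → F.crossEffect T x = 0) (f : Fin n → Fin n) :
    ∑ S with S.card = t, F.symmetrize n (F.crossEffect S (F.push f x)) =
      ∑ T with T.card = t ∧ (T.image f).card = t, F.symmetrize n (F.crossEffect T x) := by
  have h1 : ∀ S : Finset (Fin n), F.symmetrize n (F.crossEffect S (F.push f x)) =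
      ∑ T with T.image f = S, F.symmetrize n (F.push f (F.crossEffect T x)) := fun S => by
    have := LinearMap.congr_fun (F.crossEffect_comp_push f S) x
    rw [LinearMap.sum_apply] at this
    rw [← map_sum]
    exact congrArg _ this
  simp only [h1, Finset.sum_filter]
  have h2 : ∀ S : Finset (Fin n),
      (if S.card = t then ∑ T : Finset (Fin n),
        if T.image f = S then F.symmetrize n (F.push f (F.crossEffect T x)) else 0 else 0) =
      ∑ T : Finset (Fin n), if T.image f = S then
        (if (T.image f).card = t then F.symmetrize n (F.push f (F.crossEffect T x)) else 0)
        else 0 := by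
    intro S
    split_ifs with hS
    · refine Finset.sum_congr rfl fun T _ => ?_
      split_ifs <;> simp_all
    · refine (Finset.sum_eq_zero fun T _ => ?_).symm
      split_ifs <;> simp_all
  simp only [h2]
  rw [Finset.sum_comm]
  simp only [Finset.sum_ite_eq, Finset.mem_univ, if_true]
  refine Finset.sum_congr rfl fun T _ => ?_
  by_cases hf : (T.image f).card = t
  · rcases (hf ▸ Finset.card_image_le : t ≤ T.card).lt_or_eq with hT | hT
    · rw [hx T hT, if_pos hf, if_neg fun h => hT.ne' h.1, map_zero, map_zero]
    · rw [if_pos hf, if_pos ⟨hT.symm, hf⟩]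
      exact F.symmetrize_push_crossEffect (Finset.card_image_iff.1 (hf.trans hT)) x
  · rw [if_neg hf, if_neg fun h => hf h.2]

theorem eq_zero_of_avgPush_eq_zero {n : ℕ} {x : F.obj (EuclSpace.std n)}
    (hx : ∀ σ : Equiv.Perm (Fin n), F.push σ x = x) (h : F.avgPush n n x = 0) : x = 0 := by
  -- Downward induction on the size of the support, from `n`.
  have key : ∀ s : ℕ, ∀ T : Finset (Fin n), n - T.card = s → F.crossEffect T x = 0 := by
    intro s
    induction s using Nat.strong_induction_on with
    | _ s ih =>
      intro T₀ hT₀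
      have hle : ∀ T : Finset (Fin n), T.card ≤ n := fun T => by
        simpa using Finset.card_le_univ T
      have hgt : ∀ T : Finset (Fin n), T₀.card < T.card → F.crossEffect T x = 0 := by
        intro T hT
        refine ih (n - T.card) ?_ T rfl
        have := hle T
        omega
      refine F.crossEffect_eq_zero_of_symmetrize hx (fun T hT => ?_) T₀ rfl
      rw [F.symmetrize_crossEffect_congr hT hx]
      have hsum : ∑ f : Fin n → Fin n, F.push f x = 0 := by
        simpa [avgPush, Fintype.card_eq_zero_iff] using h
      have h1 : ∑ f : Fin n → Fin n, ∑ S with S.card = T₀.card,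
          F.symmetrize n (F.crossEffect S (F.push f x)) = 0 := by
        rw [Finset.sum_comm]
        refine Finset.sum_eq_zero fun S _ => ?_
        rw [← map_sum, ← map_sum, hsum, map_zero, map_zero]
      have h2 : ∀ f : Fin n → Fin n, ∑ S with S.card = T₀.card,
          F.symmetrize n (F.crossEffect S (F.push f x)) =
          (Finset.univ.filter fun T : Finset (Fin n) =>
            T.card = T₀.card ∧ (T.image f).card = T₀.card).card •
            F.symmetrize n (F.crossEffect T₀ x) := by
        intro f
        rw [F.sum_symmetrize_crossEffect_push hgt, ← Finset.sum_const]
        exact Finset.sum_congr rfl fun T hT =>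
          F.symmetrize_crossEffect_congr (Finset.mem_filter.1 hT).2.1 hx
      simp only [h2] at h1
      rw [← Finset.sum_smul, ← Nat.cast_smul_eq_nsmul ℝ, smul_eq_zero, Nat.cast_eq_zero] at h1
      refine h1.resolve_left fun h0 => ?_
      -- The coefficient counts pairs `(f, T)` with `T` and `f(T)` both of the size of `T₀`; it is
      -- nonzero because `f = id`, `T = T₀` is counted.
      have := Finset.sum_eq_zero_iff.1 h0 _root_.id (Finset.mem_univ _)
      rw [Finset.card_eq_zero] at this
      exact Finset.notMem_empty T₀ (this ▸ by simp)
  rw [← F.sum_crossEffect_apply x]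
  exact Finset.sum_eq_zero fun T _ => key _ T rfl

end Construction

/-! ### Averages over random maps -/

/-- A map whose fibres are all copies of `Z` sends the uniform distribution to the uniform
distribution. -/
theorem inv_card_smul_sum_comp {X Y Z M : Type*} [Fintype X] [Fintype Y] [Fintype Z] [Nonempty Z]
    [AddCommGroup M] [Module ℝ M] (e : Y × Z ≃ X) (π : X → Y) (hπ : ∀ y z, π (e (y, z)) = y)
    (G : Y → M) :
    (Fintype.card X : ℝ)⁻¹ • ∑ x, G (π x) = (Fintype.card Y : ℝ)⁻¹ • ∑ y, G y := by
  rw [← Equiv.sum_comp e, Fintype.sum_prod_type, ← Fintype.card_congr e, Fintype.card_prod]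
  simp only [hπ, Finset.sum_const, Finset.card_univ]
  rw [← Finset.smul_sum, ← Nat.cast_smul_eq_nsmul ℝ, smul_smul, Nat.cast_mul, mul_inv, mul_assoc,
    inv_mul_cancel₀ (by positivity), mul_one]

namespace Construction

variable (F : Construction)

theorem avgPush_apply {m n : ℕ} (x : F.obj (EuclSpace.std m)) :
    F.avgPush m n x =
      (Fintype.card (Fin m → Fin n) : ℝ)⁻¹ • ∑ f : Fin m → Fin n, F.push f x := by
  simp only [avgPush, LinearMap.smul_apply, LinearMap.sum_apply]

theorem adjoint_avgPush_apply {m n : ℕ} (x : F.obj (EuclSpace.std n)) :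
    LinearMap.adjoint (F.avgPush m n) x = (Fintype.card (Fin m → Fin n) : ℝ)⁻¹ •
      ∑ f : Fin m → Fin n, LinearMap.adjoint (F.push f) x := by
  simp only [avgPush, map_smulₛₗ, map_sum, LinearMap.smul_apply, LinearMap.sum_apply,
    conj_trivial]

theorem push_comp_avgPush {m n n' : ℕ} (g : Fin n → Fin n') :
    F.push g ∘ₗ F.avgPush m n =
      (Fintype.card (Fin m → Fin n) : ℝ)⁻¹ • ∑ f : Fin m → Fin n, F.push (g ∘ f) := by
  simp only [avgPush, LinearMap.comp_smul, LinearMap.comp_finsetSum, push_comp]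

theorem avgPush_comp_push {m m' n : ℕ} (g : Fin m' → Fin m) :
    F.avgPush m n ∘ₗ F.push g =
      (Fintype.card (Fin m → Fin n) : ℝ)⁻¹ • ∑ f : Fin m → Fin n, F.push (f ∘ g) := by
  simp only [avgPush, LinearMap.smul_comp, LinearMap.finsetSum_comp, push_comp]

theorem push_perm_comp_avgPush {m n : ℕ} (σ : Equiv.Perm (Fin n)) :
    F.push σ ∘ₗ F.avgPush m n = F.avgPush m n := by
  rw [push_comp_avgPush, avgPush]
  congr 1
  exact Equiv.sum_comp ((Equiv.refl (Fin m)).arrowCongr σ) F.push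

theorem avgPush_comp_push_perm {m n : ℕ} (σ : Equiv.Perm (Fin m)) :
    F.avgPush m n ∘ₗ F.push σ = F.avgPush m n := by
  rw [avgPush_comp_push, avgPush]
  congr 1
  exact Equiv.sum_comp (σ.symm.arrowCongr (Equiv.refl (Fin n))) F.push

/-- The restriction of a uniform random map to an initial segment is uniform. -/
theorem avgPush_comp_push_castLE {m m' : ℕ} (h : m ≤ m') (n : ℕ+) :
    F.avgPush m' n ∘ₗ F.push (Fin.castLE h) = F.avgPush m n := by
  obtain ⟨l, rfl⟩ := Nat.exists_eq_add_of_le h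
  rw [avgPush_comp_push, avgPush]
  have : Nonempty (Fin l → Fin n) := ⟨fun _ => ⟨0, n.pos⟩⟩
  refine inv_card_smul_sum_comp (Fin.appendEquiv m l) (fun f => f ∘ Fin.castLE h)
    (fun y z => ?_) F.push
  funext i
  exact Fin.append_left y z i

/-- The blocks have equal size, so recording only the block of each value of a uniform random map
gives a uniform random map. -/
theorem push_blockIndex_comp_avgPush (m : ℕ) {n N : ℕ+} (h : n ∣ N) :
    F.push (blockIndex h) ∘ₗ F.avgPush m N = F.avgPush m n := by
  rw [push_comp_avgPush, avgPush]
  have hpos : 0 < (N / n : ℕ) := Nat.div_pos (PNat.le_of_dvd h) n.pos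
  have : Nonempty (Fin m → Fin (N / n : ℕ)) := ⟨fun _ => ⟨0, hpos⟩⟩
  refine inv_card_smul_sum_comp ((Equiv.arrowProdEquivProdArrow (Fin m) (fun _ => Fin n)
    (fun _ => Fin (N / n : ℕ))).symm.trans ((Equiv.refl (Fin m)).arrowCongr (blockEquiv h)))
    (fun f => blockIndex h ∘ f) (fun y z => ?_) F.push
  funext i
  change blockIndex h (blockEquiv h (y i, z i)) = y i
  rw [← blockEquiv_symm_fst, Equiv.symm_apply_apply]

theorem adjoint_push_perm {n : ℕ} (σ : Equiv.Perm (Fin n)) :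
    LinearMap.adjoint (F.push σ) = F.push (σ⁻¹ : Equiv.Perm (Fin n)) := by
  refine (F.adjoint_map _).trans (congrArg F.map ?_)
  rw [pushforward_perm σ⁻¹]
  exact adjoint_pushforward σ

theorem push_symmetrize {n : ℕ} (σ : Equiv.Perm (Fin n)) (x : F.obj (EuclSpace.std n)) :
    F.push σ (F.symmetrize n x) = F.symmetrize n x := by
  simp only [symmetrize, LinearMap.smul_apply, LinearMap.sum_apply, map_smul, map_sum, push_push]
  congr 1
  exact Equiv.sum_comp (Equiv.mulLeft σ) fun τ : Equiv.Perm (Fin n) => F.push τ x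

/-- On invariants the average is injective, hence surjective: `x` is the average `A y` of some `y`,
and `⟪x, x⟫ = ⟪A⋆ x, y⟫ = 0`. -/
theorem eq_zero_of_adjoint_avgPush_eq_zero {n : ℕ} {x : F.obj (EuclSpace.std n)}
    (hx : ∀ σ : Equiv.Perm (Fin n), F.push σ x = x)
    (h : LinearMap.adjoint (F.avgPush n n) x = 0) : x = 0 := by
  let W : Submodule ℝ (F.obj (EuclSpace.std n)) := LinearMap.range (F.symmetrize n)
  have hinv : ∀ y ∈ W, ∀ σ : Equiv.Perm (Fin n), F.push σ y = y := by
    rintro _ ⟨y, rfl⟩ σ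
    exact F.push_symmetrize σ y
  have hW : ∀ y, (∀ σ : Equiv.Perm (Fin n), F.push σ y = y) → y ∈ W := fun y hy =>
    ⟨y, F.symmetrize_eq_self hy⟩
  let A : W →ₗ[ℝ] W := (F.avgPush n n).restrict fun y _ => hW _ fun σ =>
    LinearMap.congr_fun (F.push_perm_comp_avgPush σ) y
  have hA : Function.Injective A := by
    rw [injective_iff_map_eq_zero]
    intro y hy
    exact Subtype.ext (F.eq_zero_of_avgPush_eq_zero (hinv y y.2) (congrArg Subtype.val hy))
  obtain ⟨y, hy⟩ := (LinearMap.injective_iff_surjective.1 hA) ⟨x, hW x hx⟩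
  have hy' : F.avgPush n n y = x := congrArg Subtype.val hy
  rw [← inner_self_eq_zero (𝕜 := ℝ)]
  nth_rw 2 [← hy']
  rw [← LinearMap.adjoint_inner_left, h, inner_zero_left]

/-! ### Stabilization of invariants under zero-padding -/

theorem symmetrize_push_castLE_symmetrize {n N : ℕ} (h : n ≤ N) (x : F.obj (EuclSpace.std n)) :
    F.symmetrize N (F.push (Fin.castLE h) (F.symmetrize n x)) =
      F.symmetrize N (F.push (Fin.castLE h) x) := by
  have h1 : ∀ σ : Equiv.Perm (Fin n), F.symmetrize N (F.push (Fin.castLE h) (F.push σ x)) =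
      F.symmetrize N (F.push (Fin.castLE h) x) := fun σ => by
    rw [← F.symmetrize_push (zeroPadEmb h σ) (F.push (Fin.castLE h) x), push_push, push_push]
    congr 3
    funext i
    exact (zeroPadEmb_lt h σ (Fin.castLE h i) i.2).symm
  rw [symmetrize.eq_def F n]
  simp only [LinearMap.smul_apply, LinearMap.sum_apply, map_smul, map_sum, h1,
    Finset.sum_const, Finset.card_univ]
  rw [← Nat.cast_smul_eq_nsmul ℝ, smul_smul, inv_mul_cancel₀ (by positivity), one_smul]

theorem proj_eq_push_castLE {n N : ℕ} (h : n ≤ N) :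
    F.proj ({i : Fin N | (i : ℕ) < n} : Finset (Fin N)) = F.push (Fin.castLE h) ∘ₗ
      F.map (X := EuclSpace.std N) (Y := EuclSpace.std n) (pullback (Fin.castLE h)) := by
  refine (congrArg F.map ?_).trans (F.map_comp _ _)
  change coordProj _ = pushforward (Fin.castLE h) ∘ₗ pullback (Fin.castLE h)
  rw [pushforward_castLE]
  refine LinearMap.ext fun x => PiLp.ext fun i => ?_
  by_cases hi : (i : ℕ) < n <;> simp [coordProj_apply, zeroPad_apply, hi, pullback_apply]

/-- Components of support larger than `n` vanish by degree. Up to symmetrization, the others can be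
moved into the first `n` coordinates, where they are zero-padded from `F(ℝⁿ)`. -/
theorem exists_symmetrize_push_castLE_eq {n N : ℕ} (h : n ≤ N) (hn : F.degree ≤ n)
    {x : F.obj (EuclSpace.std N)} (hx : ∀ σ : Equiv.Perm (Fin N), F.push σ x = x) :
    ∃ y : F.obj (EuclSpace.std n), F.symmetrize N (F.push (Fin.castLE h) y) = x := by
  have h1 : ∀ T : Finset (Fin N), ∃ y : F.obj (EuclSpace.std n),
      F.symmetrize N (F.push (Fin.castLE h) y) = F.symmetrize N (F.crossEffect T x) := by
    intro T
    rcases lt_or_ge n T.card with hT | hT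
    · refine ⟨0, ?_⟩
      rw [F.crossEffect_eq_zero (hn.trans_lt hT), map_zero, map_zero, LinearMap.zero_apply,
        map_zero]
    · let B : Finset (Fin N) := {i : Fin N | (i : ℕ) < n}
      have hB : B = Finset.univ.map (Fin.castLEEmb h) := by
        ext i
        simp only [B, Finset.mem_filter, Finset.mem_univ, true_and, Finset.mem_map]
        exact ⟨fun hi => ⟨⟨i, hi⟩, rfl⟩, fun ⟨j, hj⟩ => hj ▸ j.2⟩
      have hB' : B.card = n := by rw [hB, Finset.card_map, Finset.card_univ, Fintype.card_fin]
      obtain ⟨S, hSB, hS⟩ := Finset.exists_subset_card_eq (hT.trans_eq hB'.symm)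
      refine ⟨F.map (X := EuclSpace.std N) (Y := EuclSpace.std n) (pullback (Fin.castLE h))
        (F.crossEffect S x), ?_⟩
      rw [F.symmetrize_crossEffect_congr hS.symm hx]
      have h2 := LinearMap.congr_fun (F.proj_comp_crossEffect S B) x
      rw [if_pos hSB] at h2
      have h3 := LinearMap.congr_fun (F.proj_eq_push_castLE h) (F.crossEffect S x)
      exact congrArg _ (h3.symm.trans h2)
  choose y hy using h1
  refine ⟨∑ T, y T, ?_⟩
  rw [map_sum, map_sum, Finset.sum_congr rfl fun T _ => hy T, ← map_sum, F.sum_crossEffect_apply,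
    F.symmetrize_eq_self hx]

end Construction

/-! ### Limits of invariants of consistent sequences -/

namespace ConsistentSequence

variable {V : ℕ+ → EuclSpace} (S : ConsistentSequence V)

instance : Nonempty S.Index := ⟨S.index 1⟩

instance : IsDirectedOrder S.Index := ⟨S.directed⟩

theorem exists_toFreelySymmetrized (z : S.FreelySymmetrized) :
    ∃ (k : ℕ+) (v : S.invariants k), S.toFreelySymmetrized k v = z :=
  Module.DirectLimit.exists_of z

theorem toFreelySymmetrized_symMap {n N : ℕ+} (h : S.order.le n N) (v : S.invariants n) :
    S.toFreelySymmetrized N (S.symMap h v) = S.toFreelySymmetrized n v :=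
  Module.DirectLimit.of_f (R := ℝ) (ι := S.Index) (G := fun n : S.Index => S.invariants n.val)
    (f := fun n N (h : n ≤ N) => S.symMap (n := n.val) (N := N.val) h)
    (i := S.index n) (j := S.index N) (hij := h) (x := v)

theorem inner_action_left (n : ℕ+) (g : Equiv.Perm (Fin n)) {x : V n} (hx : x ∈ S.invariants n)
    (y : V n) : inner ℝ x (S.action n g y) = inner ℝ x y := by
  nth_rw 1 [← hx g]
  exact S.action_inner n g x y

theorem inner_reynolds (n : ℕ+) {x : V n} (hx : x ∈ S.invariants n) (y : V n) :
    inner ℝ x (S.reynolds n y) = inner ℝ x y := by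
  simp only [reynolds, LinearMap.smul_apply, LinearMap.sum_apply, inner_smul_right, inner_sum,
    S.inner_action_left n _ hx, Finset.sum_const, Finset.card_univ, nsmul_eq_mul]
  rw [← mul_assoc, inv_mul_cancel₀ (by positivity), one_mul]

/-- Linear maps out of the space of freely-symmetrized elements. -/
noncomputable def liftFreelySymmetrized {M : Type*} [AddCommGroup M] [Module ℝ M]
    (g : ∀ n, S.invariants n →ₗ[ℝ] M)
    (hg : ∀ (n N : ℕ+) (h : S.order.le n N) (v : S.invariants n),
      g N (S.symMap h v) = g n v) : S.FreelySymmetrized →ₗ[ℝ] M :=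
  Module.DirectLimit.lift ℝ S.Index (fun n : S.Index => S.invariants n.val)
    (fun n N (h : n ≤ N) => S.symMap (n := n.val) (N := N.val) h) (fun n => g n.val)
    (fun n N h v => hg n.val N.val h v)

theorem liftFreelySymmetrized_apply {M : Type*} [AddCommGroup M] [Module ℝ M]
    (g : ∀ n, S.invariants n →ₗ[ℝ] M)
    (hg : ∀ (n N : ℕ+) (h : S.order.le n N) (v : S.invariants n),
      g N (S.symMap h v) = g n v) (n : ℕ+) (v : S.invariants n) :
    S.liftFreelySymmetrized g hg (S.toFreelySymmetrized n v) = g n v :=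
  Module.DirectLimit.lift_of (R := ℝ) (ι := S.Index) (G := fun n : S.Index => S.invariants n.val)
    (f := fun n N (h : n ≤ N) => S.symMap (n := n.val) (N := N.val) h) (fun n => g n.val)
    (fun n N h v => hg n.val N.val h v) (i := S.index n) v

theorem inner_symMap (w : S.freelyDescribed) {n N : ℕ+} (h : S.order.le n N)
    (v : S.invariants n) :
    inner ℝ ((w : ∀ n, V n) N) (S.symMap h v : V N) =
      inner ℝ ((w : ∀ n, V n) n) (v : V n) := by
  change inner ℝ ((w : ∀ n, V n) N) (S.reynolds N (S.φ h v)) = _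
  rw [S.inner_reynolds N (w.2.1 N), ← LinearMap.adjoint_inner_left, w.2.2 _ _ h]

/-- The functional on freely-symmetrized elements of a freely-described element. -/
noncomputable def functional (w : S.freelyDescribed) : Module.Dual ℝ S.FreelySymmetrized :=
  S.liftFreelySymmetrized
    (fun n => innerₗ (V n) ((w : ∀ n, V n) n) ∘ₗ (S.invariants n).subtype)
    (fun _ _ h v => S.inner_symMap w h v)

theorem functional_apply (w : S.freelyDescribed) (n : ℕ+) (v : S.invariants n) :
    S.functional w (S.toFreelySymmetrized n v) = inner ℝ ((w : ∀ n, V n) n) (v : V n) :=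
  S.liftFreelySymmetrized_apply
    (fun n => innerₗ (V n) ((w : ∀ n, V n) n) ∘ₗ (S.invariants n).subtype)
    (fun _ _ h v => S.inner_symMap w h v) n v

/-- The pairing of freely-described elements with freely-symmetrized elements. -/
noncomputable def pairing : S.freelyDescribed →ₗ[ℝ] Module.Dual ℝ S.FreelySymmetrized where
  toFun := S.functional
  map_add' w w' := by
    refine LinearMap.ext fun z => ?_
    obtain ⟨k, v, rfl⟩ := S.exists_toFreelySymmetrized z
    exact (S.functional_apply (w + w') k v).trans ((inner_add_left _ _ _).trans
      (congrArg₂ (· + ·) (S.functional_apply w k v) (S.functional_apply w' k v)).symm)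
  map_smul' c w := by
    refine LinearMap.ext fun z => ?_
    obtain ⟨k, v, rfl⟩ := S.exists_toFreelySymmetrized z
    exact (S.functional_apply (c • w) k v).trans ((real_inner_smul_left _ _ _).trans
      (congrArg (c * ·) (S.functional_apply w k v)).symm)

/-- Testing `w` against the class of its own entry `w n` gives the squared norm of that entry. -/
theorem pairing_injective : Function.Injective S.pairing := by
  rw [injective_iff_map_eq_zero]
  intro w hw
  refine Subtype.ext (funext fun n => ?_)
  have h := S.functional_apply w n ⟨(w : ∀ n, V n) n, w.2.1 n⟩
  exact inner_self_eq_zero.1 (h.symm.trans (LinearMap.congr_fun hw _))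

end ConsistentSequence

/-! ### The de Finetti isomorphism -/

namespace Construction

variable (F : Construction)

theorem apply_zeroPadding_action (n : ℕ+) (σ : Equiv.Perm (Fin n)) :
    (F.apply zeroPadding).action n σ = F.push σ :=
  congrArg F.map (pushforward_perm σ).symm

theorem apply_duplication_action (n : ℕ+) (σ : Equiv.Perm (Fin n)) :
    (F.apply duplication).action n σ = F.push σ :=
  congrArg F.map (pushforward_perm σ).symm

theorem apply_zeroPadding_φ {n N : ℕ+} (h : (F.apply zeroPadding).order.le n N) :
    (F.apply zeroPadding).φ h = F.push (Fin.castLE (show (n : ℕ) ≤ N from h)) :=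
  congrArg F.map (pushforward_castLE _).symm

theorem adjoint_apply_duplication_φ {n N : ℕ+} (h : (F.apply duplication).order.le n N) :
    LinearMap.adjoint ((F.apply duplication).φ h) =
      F.push (blockIndex (show n ∣ N from h)) :=
  F.adjoint_map _

theorem apply_zeroPadding_reynolds (n : ℕ+) :
    (F.apply zeroPadding).reynolds n = F.symmetrize n := by
  simp only [ConsistentSequence.reynolds, symmetrize, apply_zeroPadding_action]

theorem finite_freelySymmetrized_zeroPadding :
    Module.Finite ℝ (F.apply zeroPadding).FreelySymmetrized := by
  -- The successor gives a positive index even when the degree is `0`, as for `Sym^0`.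
  let d : ℕ+ := F.degree.succPNat
  refine Module.Finite.of_surjective ((F.apply zeroPadding).toFreelySymmetrized d) fun z => ?_
  obtain ⟨k, v, rfl⟩ := (F.apply zeroPadding).exists_toFreelySymmetrized z
  have hd : (F.apply zeroPadding).order.le d (max k d) := le_max_right k d
  have hk : (F.apply zeroPadding).order.le k (max k d) := le_max_left k d
  rw [← (F.apply zeroPadding).toFreelySymmetrized_symMap hk]
  obtain ⟨y, hy⟩ := F.exists_symmetrize_push_castLE_eq (show (d : ℕ) ≤ (max k d : ℕ+) from hd)
    (Nat.le_succ _) (x := ((F.apply zeroPadding).symMap hk v).1) fun σ => by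
      rw [← apply_zeroPadding_action]
      exact ((F.apply zeroPadding).symMap hk v).2 σ
  refine ⟨⟨F.symmetrize d y, fun σ => ?_⟩, ?_⟩
  · rw [apply_zeroPadding_action]
    exact F.push_symmetrize σ y
  · rw [← (F.apply zeroPadding).toFreelySymmetrized_symMap hd]
    congr 1
    refine Subtype.ext ?_
    change (F.apply zeroPadding).reynolds _ ((F.apply zeroPadding).φ hd _) = _
    rw [apply_zeroPadding_reynolds, apply_zeroPadding_φ]
    exact (F.symmetrize_push_castLE_symmetrize _ y).trans hy

end Construction

/-! ### Averages for an FS-pair and the dimension count -/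

namespace FSPair

/-- The linear map `v ↦ 𝔼 L_{k,n}⋆ v`. -/
noncomputable def avg : (P : FSPair) → (k n : ℕ+) → (P.V k →ₗ[ℝ] P.V n)
  | duplicationOverZeroPadding F, k, n => F.avgPush k n
  | zeroPaddingOverDuplication F, k, n => LinearMap.adjoint (F.avgPush n k)

theorem avg_apply (P : FSPair) (k n : ℕ+) (v : P.V k) :
    P.avg k n v = P.expectedAdjoint k n v := by
  cases P with
  | duplicationOverZeroPadding F =>
    refine (F.avgPush_apply v).trans (congrArg _ (Finset.sum_congr rfl fun f _ => ?_))
    exact LinearMap.congr_fun (F.adjoint_map (X := EuclSpace.std n) (Y := EuclSpace.std k)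
      (pullback f)).symm v
  | zeroPaddingOverDuplication F =>
    refine (F.adjoint_avgPush_apply v).trans (congrArg _ (Finset.sum_congr rfl fun f _ => ?_))
    exact LinearMap.congr_fun (congrArg LinearMap.adjoint
      (F.adjoint_map (X := EuclSpace.std k) (Y := EuclSpace.std n) (pullback f)).symm) v

theorem action_comp_avg (P : FSPair) (k n : ℕ+) (σ : Equiv.Perm (Fin n)) :
    P.U.action n σ ∘ₗ P.avg k n = P.avg k n := by
  cases P with
  | duplicationOverZeroPadding F =>
    exact (congrArg (· ∘ₗ F.avgPush k n) (F.apply_duplication_action n σ)).trans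
      (F.push_perm_comp_avgPush σ)
  | zeroPaddingOverDuplication F =>
    refine (congrArg (· ∘ₗ LinearMap.adjoint (F.avgPush n k))
      (F.apply_zeroPadding_action n σ)).trans ?_
    change F.push σ ∘ₗ LinearMap.adjoint (F.avgPush n k) = LinearMap.adjoint (F.avgPush n k)
    conv_rhs => rw [← F.avgPush_comp_push_perm σ⁻¹, LinearMap.adjoint_comp, F.adjoint_push_perm,
      inv_inv]

theorem avg_comp_action (P : FSPair) (k n : ℕ+) (σ : Equiv.Perm (Fin k)) :
    P.avg k n ∘ₗ P.L.action k σ = P.avg k n := by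
  cases P with
  | duplicationOverZeroPadding F =>
    exact (congrArg (F.avgPush k n ∘ₗ ·) (F.apply_zeroPadding_action k σ)).trans
      (F.avgPush_comp_push_perm σ)
  | zeroPaddingOverDuplication F =>
    refine (congrArg (LinearMap.adjoint (F.avgPush n k) ∘ₗ ·)
      (F.apply_duplication_action k σ)).trans ?_
    change LinearMap.adjoint (F.avgPush n k) ∘ₗ F.push σ = LinearMap.adjoint (F.avgPush n k)
    conv_rhs => rw [← F.push_perm_comp_avgPush σ⁻¹, LinearMap.adjoint_comp, F.adjoint_push_perm,
      inv_inv]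

/-- One uniformity fact serves each type of pair: equipartition for `U = F(D)`, the adjoint of
restriction for `U = F(Z)`. In `avg_comp_φ` the roles are exchanged. -/
theorem adjoint_φ_comp_avg (P : FSPair) (k : ℕ+) {n N : ℕ+} (h : P.U.order.le n N) :
    LinearMap.adjoint (P.U.φ h) ∘ₗ P.avg k N = P.avg k n := by
  cases P with
  | duplicationOverZeroPadding F =>
    exact (congrArg (· ∘ₗ F.avgPush k N) (F.adjoint_apply_duplication_φ h)).trans
      (F.push_blockIndex_comp_avgPush k h)
  | zeroPaddingOverDuplication F =>
    refine (LinearMap.adjoint_comp _ _).symm.trans (congrArg LinearMap.adjoint ?_)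
    exact (congrArg (F.avgPush N k ∘ₗ ·) (F.apply_zeroPadding_φ h)).trans
      (F.avgPush_comp_push_castLE _ k)

theorem avg_comp_φ (P : FSPair) {k N : ℕ+} (n : ℕ+) (h : P.L.order.le k N) :
    P.avg N n ∘ₗ P.L.φ h = P.avg k n := by
  cases P with
  | duplicationOverZeroPadding F =>
    exact (congrArg (F.avgPush N n ∘ₗ ·) (F.apply_zeroPadding_φ h)).trans
      (F.avgPush_comp_push_castLE _ n)
  | zeroPaddingOverDuplication F =>
    refine LinearMap.adjoint.injective ((LinearMap.adjoint_comp _ _).trans ?_)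
    refine (congrArg₂ (· ∘ₗ ·) (F.adjoint_apply_duplication_φ h)
      (LinearMap.adjoint_adjoint (F.avgPush n N))).trans ?_
    exact (F.push_blockIndex_comp_avgPush n h).trans (LinearMap.adjoint_adjoint _).symm

theorem avg_reynolds (P : FSPair) (k n : ℕ+) (x : P.V k) :
    P.avg k n (P.L.reynolds k x) = P.avg k n x := by
  have h : ∀ σ, P.avg k n (P.L.action k σ x) = P.avg k n x :=
    fun σ => LinearMap.congr_fun (P.avg_comp_action k n σ) x
  simp only [ConsistentSequence.reynolds, LinearMap.smul_apply, LinearMap.sum_apply, map_smul,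
    map_sum, h, Finset.sum_const, Finset.card_univ]
  rw [← Nat.cast_smul_eq_nsmul ℝ, smul_smul, inv_mul_cancel₀ (by positivity), one_smul]

theorem eq_zero_of_avg_eq_zero (P : FSPair) {n : ℕ+} {x : P.V n} (hx : x ∈ P.L.invariants n)
    (h : P.avg n n x = 0) : x = 0 := by
  cases P with
  | duplicationOverZeroPadding F =>
    refine F.eq_zero_of_avgPush_eq_zero (fun σ => ?_) h
    exact (LinearMap.congr_fun (F.apply_zeroPadding_action n σ) x).symm.trans (hx σ)
  | zeroPaddingOverDuplication F =>
    refine F.eq_zero_of_adjoint_avgPush_eq_zero (fun σ => ?_) h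
    exact (LinearMap.congr_fun (F.apply_duplication_action n σ) x).symm.trans (hx σ)

/-- The sequence `(𝔼 L_{k,n}⋆ v)_n` as a freely-described element. -/
noncomputable def describe (P : FSPair) (k : ℕ+) : P.V k →ₗ[ℝ] P.U.freelyDescribed :=
  (LinearMap.pi fun n => P.avg k n).codRestrict _ fun v =>
    ⟨fun n σ => LinearMap.congr_fun (P.action_comp_avg k n σ) v,
      fun _ _ h => LinearMap.congr_fun (P.adjoint_φ_comp_avg k h) v⟩

theorem describe_symMap (P : FSPair) {k N : ℕ+} (h : P.L.order.le k N)
    (v : P.L.invariants k) : P.describe N (P.L.symMap h v) = P.describe k v := by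
  refine Subtype.ext (funext fun n => ?_)
  change P.avg N n (P.L.reynolds N (P.L.φ h v)) = P.avg k n v
  rw [avg_reynolds]
  exact LinearMap.congr_fun (P.avg_comp_φ n h) (v : P.V k)

/-- The map from freely-symmetrized to freely-described elements. -/
noncomputable def deFinetti (P : FSPair) : P.L.FreelySymmetrized →ₗ[ℝ] P.U.freelyDescribed :=
  P.L.liftFreelySymmetrized (fun k => P.describe k ∘ₗ (P.L.invariants k).subtype)
    (fun _ _ h v => P.describe_symMap h v)

theorem deFinetti_apply (P : FSPair) (k : ℕ+) (v : P.L.invariants k) (n : ℕ+) :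
    (P.deFinetti (P.L.toFreelySymmetrized k v) : ∀ n, P.V n) n = P.expectedAdjoint k n v := by
  rw [← avg_apply]
  exact congrArg (fun w : P.U.freelyDescribed => (w : ∀ n, P.V n) n)
    (P.L.liftFreelySymmetrized_apply (fun k => P.describe k ∘ₗ (P.L.invariants k).subtype)
      (fun _ _ h v => P.describe_symMap h v) k v)

/-- The entry at `n = k` alone already determines `v`. -/
theorem deFinetti_injective (P : FSPair) : Function.Injective P.deFinetti := by
  rw [injective_iff_map_eq_zero]
  intro z hz
  obtain ⟨k, v, rfl⟩ := P.L.exists_toFreelySymmetrized z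
  have h := P.deFinetti_apply k v k
  rw [hz, ← avg_apply] at h
  rw [show v = 0 from Subtype.ext (P.eq_zero_of_avg_eq_zero v.2 h.symm), map_zero]

/-- Swapping the members of the pair closes the chain of inequalities into a cycle, forcing equality
throughout. -/
theorem finite_finrank_eq (P : FSPair) : Module.Finite ℝ P.L.FreelySymmetrized ∧
    Module.Finite ℝ P.U.freelyDescribed ∧
    Module.finrank ℝ P.L.FreelySymmetrized = Module.finrank ℝ P.U.freelyDescribed := by
  have key : ∀ P : FSPair, Module.Finite ℝ P.U.FreelySymmetrized →
      Module.Finite ℝ P.L.FreelySymmetrized ∧ Module.Finite ℝ P.U.freelyDescribed ∧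
      Module.finrank ℝ P.L.FreelySymmetrized ≤ Module.finrank ℝ P.U.freelyDescribed ∧
      Module.finrank ℝ P.U.freelyDescribed ≤ Module.finrank ℝ P.U.FreelySymmetrized := by
    intro P _
    have h1 : Module.Finite ℝ P.U.freelyDescribed :=
      Module.Finite.of_injective _ P.U.pairing_injective
    refine ⟨Module.Finite.of_injective _ P.deFinetti_injective, h1,
      LinearMap.finrank_le_finrank_of_injective P.deFinetti_injective, ?_⟩
    rw [← Subspace.dual_finrank_eq (V := P.U.FreelySymmetrized)]
    exact LinearMap.finrank_le_finrank_of_injective P.U.pairing_injective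
  cases P with
  | duplicationOverZeroPadding F =>
    -- Finiteness is known directly only for zero-padding, so the pair with `U = F(Z)` comes first;
    -- it yields finiteness for duplication.
    obtain ⟨h1, -, h2, h3⟩ := key (zeroPaddingOverDuplication F)
      F.finite_freelySymmetrized_zeroPadding
    obtain ⟨h4, h5, h6, h7⟩ := key (duplicationOverZeroPadding F) h1
    exact ⟨h4, h5, h6.antisymm (h7.trans (h2.trans h3))⟩
  | zeroPaddingOverDuplication F =>
    obtain ⟨h1, h5, h2, h3⟩ := key (zeroPaddingOverDuplication F)
      F.finite_freelySymmetrized_zeroPadding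
    obtain ⟨-, -, h6, h7⟩ := key (duplicationOverZeroPadding F) h1
    exact ⟨h1, h5, h2.antisymm (h3.trans (h6.trans h7))⟩

end FSPair

theorem mainTheorem6 (P : FSPair) :
    ∃ Φ : P.L.FreelySymmetrized ≃ₗ[ℝ] P.U.freelyDescribed,
      ∀ (k : ℕ+) (v : P.L.invariants k) (n : ℕ+),
        (Φ (P.L.toFreelySymmetrized k v) : ∀ n, P.V n) n = P.expectedAdjoint k n v := by
  obtain ⟨_, _, h⟩ := P.finite_finrank_eq
  exact ⟨LinearEquiv.ofInjectiveOfFinrankEq P.deFinetti P.deFinetti_injective h,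
    fun k v n => P.deFinetti_apply k v n⟩
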